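/- Let $\ln\Gamma$ be the principal branch of the log-Gamma function, analytic on $\mathbb{C}\setminus(-\infty,0]$ and real on $(0,\infty)$, and let $\vartheta(t)=\arg\Gamma\!\left(\frac{it}{2}+\frac14\right)-\frac t2\log\pi$ be the Riemann–Siegel theta function, where the argument is continuous in $t$ and $\vartheta(0)=0$ (that is, the argument is $\Im\ln\Gamma$). For integers $k\ge 1$ put $$T_k(z)=\frac{B_{2k}}{2k(2k-1)z^{2k-1}},\qquad R_k(z)=\ln\Gamma(z)-\Bigl((z-\tfrac12)\log z-z+\tfrac12\log(2\pi)+\sum_{j=1}^{k-1}T_j(z)\Bigr),$$ $$\widehat T_k(z)=T_k(2z)-T_k(z),\qquad \widehat R_k(z)=R_k(2z)-R_k(z),$$ and, for real $t>0$, $$\widetilde T_k(t)=\tfrac12|\widehat T_k(t)|=\frac{(1-2^{1-2k})|B_{2k}|}{4k(2k-1)t^{2k-1}},\qquad \widetilde R_k(t)=\Im\bigl(\tfrac12\widehat R_k(it)\bigr),$$ $$k_{\min}(t)=\min\{k\ge1:\widetilde T_k(t)\le\widetilde T_{k+1}(t)\}.$$ Consider the two approximations of $\vartheta(t)$ with $k$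 terms $$S_k(t)=\frac t2\log\frac{t}{2\pi e}-\frac\pi8+\sum_{j=1}^{k}\widetilde T_j(t),\qquad A_k(t)=S_k(t)+\tfrac12\arctan(e^{-\pi t}).$$ Then the following hold. 1. For every $t>0$ the minimum defining $k_{\min}(t)$ exists, and $\widetilde T_{k_{\min}(t)}(t)=\min_{j\ge1}\widetilde T_j(t)$. 2. As $t\to+\infty$, $k_{\min}(t)=\pi t+O(1)$. 3. As $t\to+\infty$ with $k=\pi t+O(1)$ (the constants and thresholds below depend only on the bound for the $O(1)$ term, so that the estimates are uniform in $k$), $$\widetilde T_k(t)=\frac{e^{-2\pi t}}{2\pi\sqrt t}\Bigl(1+O\bigl(\tfrac1t\bigr)\Bigr),\qquad |\widetilde R_{k+1}(t)|<\tfrac12e^{-2\pi t}\Bigl(1+O\bigl(\tfrac1t\bigr)\Bigr),$$ $$|\vartheta(t)-A_k(t)|<\tfrac12e^{-2\pi t}\Bigl(1+O\bigl(\tfrac1t\bigr)\Bigr),\qquad \vartheta(t)-S_k(t)=\tfrac12e^{-\pi t}+O(e^{-2\pi t}).$$ 4. In particular, if the series is summed up to its smallest term, then including the arctan term improves the error from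 exact order $e^{-\pi t}$ to $O(e^{-2\pi t})$: as $t\to+\infty$, $\vartheta(t)-S_{k_{\min}(t)}(t)\asymp e^{-\pi t}$ and $\vartheta(t)-A_{k_{\min}(t)}(t)=O(e^{-2\pi t})$. -/

import Mathlib

open Filter Asymptotics
open scoped Topology

namespace RiemannSiegel

/-- The `n`-th term of the Weierstrass series of `ln Γ`. -/
noncomputable def logGammaTerm (z : ℂ) (n : ℕ) : ℂ :=
  z / ((n : ℂ) + 1) - Complex.log (1 + z / ((n : ℂ) + 1))

/-- The principal branch of the log-Gamma function on the cut plane `ℂ \ (-∞, 0]`,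
`ln Γ(z) = -γ z - log z + ∑_{n ≥ 1} (z / n - log (1 + z / n))`.
It is analytic there, its exponential is `Γ`, and it is real on the positive reals: see
`differentiableOn_logGamma`, `exp_logGamma` and `logGamma_ofReal`. -/
noncomputable def logGamma (z : ℂ) : ℂ :=
  -(Real.eulerMascheroniConstant : ℂ) * z - Complex.log z + ∑' n : ℕ, logGammaTerm z n

/-- The term `T_j(z) = B_{2j} / (2j (2j-1) z^{2j-1})` of Stirling's series (for `j ≥ 1`). -/
noncomputable def stirlingTerm (j : ℕ) (z : ℂ) : ℂ :=
  (bernoulli (2 * j) : ℂ) / (2 * (j : ℂ) * (2 * (j : ℂ) - 1) * z ^ (2 * j - 1))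

/-- The remainder `R_k(z)` in Stirling's approximation of `ln Γ(z)` with `k - 1` terms. -/
noncomputable def stirlingRemainder (k : ℕ) (z : ℂ) : ℂ :=
  logGamma z - ((z - 1 / 2) * Complex.log z - z + (1 / 2) * Complex.log (2 * (Real.pi : ℂ))
    + ∑ j ∈ Finset.Ico 1 k, stirlingTerm j z)

/-- The term `T̂_j(z) = T_j(2z) - T_j(z)` of Gauss's series for `ln Γ(z + 1/2)`. -/
noncomputable def gaussTerm (j : ℕ) (z : ℂ) : ℂ :=
  stirlingTerm j (2 * z) - stirlingTerm j z

/-- The remainder `R̂_k(z) = R_k(2z) - R_k(z)` in Gauss's approximation. -/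
noncomputable def gaussRemainder (k : ℕ) (z : ℂ) : ℂ :=
  stirlingRemainder k (2 * z) - stirlingRemainder k z

/-- `T̃_j(t) = |T̂_j(t)| / 2`; an explicit form is `thetaTerm_eq`. -/
noncomputable def thetaTerm (j : ℕ) (t : ℝ) : ℝ :=
  (1 / 2) * ‖gaussTerm j (t : ℂ)‖

/-- `R̃_k(t) = Im (R̂_k(i t) / 2)`. -/
noncomputable def thetaRemainder (k : ℕ) (t : ℝ) : ℝ :=
  ((1 / 2) * gaussRemainder k (Complex.I * (t : ℂ))).im

/-- The Riemann-Siegel theta function `ϑ(t) = arg Γ(i t / 2 + 1 / 4) - (t / 2) log π`, where the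
argument is the continuous one that vanishes at `t = 0`, that is, `Im ln Γ`. -/
noncomputable def theta (t : ℝ) : ℝ :=
  (logGamma (Complex.I * (t : ℂ) / 2 + 1 / 4)).im - t / 2 * Real.log Real.pi

/-- The standard approximation of `ϑ(t)` with `k` terms,
`(t/2) log (t / (2 π e)) - π/8 + ∑_{j=1}^k T̃_j(t)`. -/
noncomputable def thetaApprox (k : ℕ) (t : ℝ) : ℝ :=
  t / 2 * Real.log (t / (2 * Real.pi * Real.exp 1)) - Real.pi / 8
    + ∑ j ∈ Finset.Icc 1 k, thetaTerm j t

/-- The approximation of `ϑ(t)` with `k` terms that includes the arctan term. -/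
noncomputable def thetaApproxArctan (k : ℕ) (t : ℝ) : ℝ :=
  thetaApprox k t + (1 / 2) * Real.arctan (Real.exp (-Real.pi * t))

/-- `k_min(t) = min {k ≥ 1 : T̃_k(t) ≤ T̃_{k+1}(t)}`. -/
noncomputable def kMin (t : ℝ) : ℕ :=
  sInf {k : ℕ | 1 ≤ k ∧ thetaTerm k t ≤ thetaTerm (k + 1) t}

theorem one_add_mem_slitPlane {z : ℂ} (hz : z ∈ Complex.slitPlane) (n : ℕ) :
    1 + z / ((n : ℂ) + 1) ∈ Complex.slitPlane := by
  have hn : (0 : ℝ) < (n : ℝ) + 1 := by positivity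
  have h1 : z / ((n : ℂ) + 1) = z / (((n : ℝ) + 1 : ℝ) : ℂ) := by push_cast; rfl
  rw [h1, Complex.mem_slitPlane_iff]
  rcases Complex.mem_slitPlane_iff.mp hz with h | h
  · left
    rw [Complex.add_re, Complex.div_ofReal_re, Complex.one_re]
    positivity
  · right
    rw [Complex.add_im, Complex.div_ofReal_im, Complex.one_im, zero_add]
    exact div_ne_zero h hn.ne'

theorem norm_logGammaTerm_le {z : ℂ} {N : ℕ} (hz : 2 * ‖z‖ ≤ N) (n : ℕ) :
    ‖logGammaTerm z (n + N)‖ ≤ (N : ℝ) ^ 2 * (1 / ((n : ℝ) + 1) ^ 2) := by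
  have hn : (0 : ℝ) < (n : ℝ) + 1 := by positivity
  set w : ℂ := z / (((n + N : ℕ) : ℂ) + 1) with hw
  have hden : ‖(((n + N : ℕ) : ℂ) + 1)‖ = (n : ℝ) + N + 1 := by
    have : (((n + N : ℕ) : ℂ) + 1) = (((n : ℝ) + N + 1 : ℝ) : ℂ) := by push_cast; rfl
    rw [this, Complex.norm_real, Real.norm_of_nonneg (by positivity)]
  have hwn : ‖w‖ = ‖z‖ / ((n : ℝ) + N + 1) := by rw [hw, norm_div, hden]
  have hhalf : ‖w‖ ≤ 1 / 2 := by
    rw [hwn, div_le_iff₀ (by positivity)]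
    nlinarith [norm_nonneg z]
  have h2 : ‖w‖ ≤ N / ((n : ℝ) + 1) := by
    rw [hwn]
    apply div_le_div₀ (by positivity) _ hn _
    · linarith [norm_nonneg z]
    · linarith [(Nat.cast_nonneg N : (0 : ℝ) ≤ N)]
  have h3 := Complex.norm_log_one_add_sub_self_le (z := w) (by linarith)
  have h4 : (1 - ‖w‖)⁻¹ ≤ 2 := by
    rw [inv_le_comm₀ (by linarith) (by norm_num)]
    linarith
  calc ‖logGammaTerm z (n + N)‖ = ‖Complex.log (1 + w) - w‖ := by
        rw [← norm_neg, logGammaTerm, ← hw, neg_sub]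
    _ ≤ ‖w‖ ^ 2 * (1 - ‖w‖)⁻¹ / 2 := h3
    _ ≤ ‖w‖ ^ 2 * 2 / 2 := by gcongr
    _ = ‖w‖ ^ 2 := by ring
    _ ≤ (N / ((n : ℝ) + 1)) ^ 2 := by gcongr
    _ = _ := by rw [div_pow, mul_one_div]

theorem summable_bound (c : ℝ) : Summable fun n : ℕ => c * (1 / ((n : ℝ) + 1) ^ 2) := by
  have h : Summable fun n : ℕ => 1 / (n : ℝ) ^ 2 := Real.summable_one_div_nat_pow.mpr (by norm_num)
  have h' := (summable_nat_add_iff 1).mpr h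
  simpa using h'.mul_left c

theorem summable_logGammaTerm (z : ℂ) : Summable (logGammaTerm z) := by
  obtain ⟨N, hN⟩ := exists_nat_ge (2 * ‖z‖)
  rw [← summable_nat_add_iff N]
  exact Summable.of_norm_bounded (summable_bound _) (norm_logGammaTerm_le hN)

theorem differentiableOn_logGamma : DifferentiableOn ℂ logGamma Complex.slitPlane := by
  have hterm : ∀ n, DifferentiableOn ℂ (fun z => logGammaTerm z n) Complex.slitPlane := by
    intro n
    unfold logGammaTerm
    refine DifferentiableOn.sub (by fun_prop) ?_
    refine DifferentiableOn.clog (by fun_prop) fun z hz => one_add_mem_slitPlane hz n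
  have hlog : DifferentiableOn ℂ (fun z => -(Real.eulerMascheroniConstant : ℂ) * z
      - Complex.log z) Complex.slitPlane :=
    DifferentiableOn.sub (by fun_prop) (DifferentiableOn.clog (by fun_prop) fun z hz => hz)
  intro z₀ hz₀
  obtain ⟨N, hN⟩ := exists_nat_ge (2 * (‖z₀‖ + 1))
  set U : Set ℂ := Complex.slitPlane ∩ Metric.ball 0 (‖z₀‖ + 1) with hU
  have hUo : IsOpen U := Complex.isOpen_slitPlane.inter Metric.isOpen_ball
  have hzU : z₀ ∈ U := ⟨hz₀, by simp⟩
  have htail : DifferentiableOn ℂ (fun z => ∑' n : ℕ, logGammaTerm z (n + N)) U := by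
    refine Complex.differentiableOn_tsum_of_summable_norm (summable_bound ((N : ℝ) ^ 2))
      (fun n => (hterm (n + N)).mono Set.inter_subset_left) hUo fun n z hz => ?_
    apply norm_logGammaTerm_le
    have := hz.2
    rw [mem_ball_zero_iff] at this
    linarith
  have hhead : DifferentiableOn ℂ (fun z => ∑ n ∈ Finset.range N, logGammaTerm z n) U :=
    DifferentiableOn.fun_sum fun n _ => (hterm n).mono Set.inter_subset_left
  have hall : DifferentiableOn ℂ logGamma U := by
    refine ((hlog.mono Set.inter_subset_left).add (hhead.add htail)).congr fun z _ => ?_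
    simp only [logGamma, Pi.add_apply]
    rw [(summable_logGammaTerm z).sum_add_tsum_nat_add N]
  exact (hall.differentiableAt (hUo.mem_nhds hzU)).differentiableWithinAt

theorem exp_logGamma {z : ℂ} (hz : z ∈ Complex.slitPlane) :
    Complex.exp (logGamma z) = Complex.Gamma z := by
  have hz0 : z ≠ 0 := Complex.slitPlane_ne_zero hz
  have h1 := (summable_logGammaTerm z).hasSum.tendsto_sum_nat
  have h2 : Tendsto (fun n : ℕ => Complex.exp (-(Real.eulerMascheroniConstant : ℂ) * z
      - Complex.log z + ∑ i ∈ Finset.range n, logGammaTerm z i)) atTop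
      (𝓝 (Complex.exp (logGamma z))) :=
    (Complex.continuous_exp.tendsto _).comp (h1.const_add _)
  have h3 : Tendsto (fun n : ℕ => Complex.exp ((((harmonic n : ℝ) - Real.log n
      - Real.eulerMascheroniConstant : ℝ) : ℂ) * z)) atTop (𝓝 1) := by
    have h := Real.tendsto_harmonic_sub_log.sub_const Real.eulerMascheroniConstant
    rw [sub_self] at h
    have h' := ((Complex.continuous_ofReal.tendsto _).comp h).mul_const z
    have h'' := (Complex.continuous_exp.tendsto _).comp h'
    simpa [Function.comp_def] using h''
  have h4 := h3.mul (Complex.GammaSeq_tendsto_Gamma z)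
  rw [one_mul] at h4
  refine tendsto_nhds_unique h2 (h4.congr' ?_)
  filter_upwards [eventually_ge_atTop 1] with n hn
  have hprod : ∀ m : ℕ, Complex.exp (∑ i ∈ Finset.range m, logGammaTerm z i)
      * ((∏ j ∈ Finset.range m, (z + ((j : ℂ) + 1))))
      = Complex.exp (z * (harmonic m : ℝ)) * (m.factorial : ℂ) := by
    intro m
    induction m with
    | zero => simp
    | succ m ih =>
      have hm : ((m : ℂ) + 1) ≠ 0 := Nat.cast_add_one_ne_zero m
      have hs := Complex.slitPlane_ne_zero (one_add_mem_slitPlane hz m)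
      have he : Complex.exp (logGammaTerm z m) * (z + ((m : ℂ) + 1))
          = Complex.exp (z / ((m : ℂ) + 1)) * ((m : ℂ) + 1) := by
        rw [logGammaTerm, Complex.exp_sub, Complex.exp_log hs]
        have : z + ((m : ℂ) + 1) = (1 + z / ((m : ℂ) + 1)) * ((m : ℂ) + 1) := by
          field_simp
          ring
        rw [this, div_mul_eq_mul_div, div_eq_iff hs]
        ring
      rw [Finset.sum_range_succ, Finset.prod_range_succ, Complex.exp_add, harmonic_succ,
        Nat.factorial_succ]
      have hh : Complex.exp (z * ((harmonic m + ((m + 1 : ℕ) : ℚ)⁻¹ : ℚ) : ℝ))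
          = Complex.exp (z * (harmonic m : ℝ)) * Complex.exp (z / ((m : ℂ) + 1)) := by
        rw [← Complex.exp_add]
        congr 1
        push_cast
        ring
      rw [hh]
      push_cast
      linear_combination (Complex.exp (logGammaTerm z m) * (z + ((m : ℂ) + 1))) * ih
        + Complex.exp (z * (harmonic m : ℝ)) * (m.factorial : ℂ) * he
  have hnz : (n : ℂ) ≠ 0 := by exact_mod_cast (by omega : n ≠ 0)
  have hp : (∏ j ∈ Finset.range n, (z + ((j : ℂ) + 1))) ≠ 0 := by
    intro h0
    have := hprod n
    rw [h0, mul_zero] at this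
    exact mul_ne_zero (Complex.exp_ne_zero _)
      (Nat.cast_ne_zero.mpr n.factorial_ne_zero) this.symm
  have hsum := eq_div_of_mul_eq hp (hprod n)
  rw [Complex.exp_add, hsum, Complex.exp_sub, Complex.exp_log hz0, Complex.GammaSeq,
    Finset.prod_range_succ', Complex.cpow_def_of_ne_zero hnz]
  have hE : Complex.exp ((((harmonic n : ℝ) - Real.log n
      - Real.eulerMascheroniConstant : ℝ) : ℂ) * z) * Complex.exp (Complex.log n * z)
      = Complex.exp (-(Real.eulerMascheroniConstant : ℂ) * z)
        * Complex.exp (z * (harmonic n : ℝ)) := by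
    rw [← Complex.exp_add, ← Complex.exp_add]
    congr 1
    push_cast
    rw [← Complex.natCast_log]
    ring
  push_cast
  push_cast at hE
  simp only [add_zero]
  generalize Complex.exp ((((harmonic n : ℚ) : ℂ) - Complex.log n
      - (Real.eulerMascheroniConstant : ℂ)) * z) = a at *
  generalize Complex.exp (Complex.log n * z) = b at *
  generalize Complex.exp (-(Real.eulerMascheroniConstant : ℂ) * z) = c at *
  generalize Complex.exp (z * ((harmonic n : ℚ) : ℂ)) = d at *
  field_simp
  linear_combination (n.factorial : ℂ) * hE

theorem logGamma_ofReal {x : ℝ} (hx : 0 < x) :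
    logGamma (x : ℂ) = (Real.log (Real.Gamma x) : ℂ) := by
  have hreal : ∃ r : ℝ, logGamma (x : ℂ) = (r : ℂ) := by
    refine ⟨-Real.eulerMascheroniConstant * x - Real.log x
      + ∑' n : ℕ, (x / ((n : ℝ) + 1) - Real.log (1 + x / ((n : ℝ) + 1))), ?_⟩
    have : ∀ n : ℕ, logGammaTerm (x : ℂ) n
        = ((x / ((n : ℝ) + 1) - Real.log (1 + x / ((n : ℝ) + 1)) : ℝ) : ℂ) := by
      intro n
      rw [logGammaTerm, Complex.ofReal_sub, Complex.ofReal_log (by positivity)]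
      push_cast
      rfl
    rw [logGamma, tsum_congr this, ← Complex.ofReal_tsum, ← Complex.ofReal_log hx.le]
    push_cast
    rfl
  obtain ⟨r, hr⟩ := hreal
  have h := exp_logGamma (z := (x : ℂ)) (Complex.ofReal_mem_slitPlane.mpr hx)
  rw [hr, Complex.Gamma_ofReal, ← Complex.ofReal_exp] at h
  rw [hr, ← Complex.ofReal_injective h, Real.log_exp]

theorem thetaTerm_eq {j : ℕ} (hj : 1 ≤ j) {t : ℝ} (ht : 0 < t) :
    thetaTerm j t = (1 - 1 / 2 ^ (2 * j - 1)) * |(bernoulli (2 * j) : ℝ)|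
      / (4 * j * (2 * j - 1) * t ^ (2 * j - 1)) := by
  have hj' : (1 : ℝ) ≤ j := by exact_mod_cast hj
  have hp : (1 : ℝ) ≤ 2 ^ (2 * j - 1) := one_le_pow₀ (by norm_num)
  have h1 : gaussTerm j (t : ℂ) = ((-((1 - 1 / 2 ^ (2 * j - 1)) * (bernoulli (2 * j) : ℝ)
      / (2 * j * (2 * j - 1) * t ^ (2 * j - 1))) : ℝ) : ℂ) := by
    have ht' : (t : ℂ) ≠ 0 := by exact_mod_cast ht.ne'
    have hj0 : (j : ℂ) ≠ 0 := by exact_mod_cast (by omega : j ≠ 0)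
    have hj1 : 2 * (j : ℂ) - 1 ≠ 0 := by
      have : (2 * (j : ℝ) - 1) ≠ 0 := by linarith
      exact_mod_cast this
    rw [gaussTerm, stirlingTerm, stirlingTerm]
    push_cast
    rw [mul_pow]
    field_simp
    ring
  have h2 : (0 : ℝ) ≤ 1 - 1 / 2 ^ (2 * j - 1) := by
    rw [sub_nonneg]
    exact (div_le_one (by linarith)).mpr hp
  have h3 : (0 : ℝ) ≤ 2 * j - 1 := by linarith
  rw [thetaTerm, h1, Complex.norm_real, Real.norm_eq_abs, abs_neg, abs_div, abs_mul,
    abs_of_nonneg h2, abs_of_nonneg (by positivity : (0 : ℝ) ≤ 2 * j * (2 * j - 1) * t ^ (2 * j - 1))]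
  field_simp
  ring

end RiemannSiegel

namespace RiemannSiegel

/-! The arctan term is exact. Put `z = it/2 + 1/4`. Duplication at `z` gives the sum of the
arguments of Gamma at `1/4 + it/2` and `3/4 + it/2` in terms of `ln Γ(it + 1/2)`. Duplication at
`it` turns that into `ln Γ(2it) - ln Γ(it)`. Since `1 - z` is conjugate to `z + 1/2`, reflection
gives the difference of the two arguments as `-arg sin(πz) = -π/4 + arctan(e^{-πt})`. Inserting
Stirling's expansion, whose terms on the imaginary axis all enter with a plus sign, gives `ϑ = A_k +
R̃_{k+1}` without error (`theta_eq`).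

The remainder is bounded by Euler–Maclaurin. The difference `R_{k+1}(z) - R_{k+1}(z+1)` is an
integral of `B_{2k}(u) (z+u)^{-2k}` over the unit interval, and `R_{k+1}(z+N) → 0`, so the remainder
is a telescoped sum. With `|B_{2k}(u)| ≤ |B_{2k}|`, `|it+u|² = t² + u²` and Wallis' product this
yields `|R_{k+1}(it)| ≤ √(πk) |T_k(t)|` (`norm_stirlingRemainder_I_mul_le`).

Euler's formula for `ζ(2k)` gives `T̃_k(t) = η(2k) (2k-2)! / ((2π)^{2k} t^{2k-1})`, with `η(2k)`
extremely close to 1. The ratio of consecutive terms is thus about `2k(2k-1)/(2πt)²`, it crosses 1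
once, and it does so near `k = πt`. There Stirling's formula gives `T̃_k ~ e^{-2πt}/(2π√t)`. The
factor `√(πk) ~ π√t` makes the remainder bound `½ e^{-2πt}`, while `arctan x = x + O(x²)` at `x =
e^{-πt}` shows what is lost without the arctan. -/

/-! ### Euler's limit and the functional equation of log-Gamma -/

theorem add_ofReal_mem_slitPlane {z : ℂ} (hz : z ∈ Complex.slitPlane) {u : ℝ} (hu : 0 ≤ u) :
    z + (u : ℂ) ∈ Complex.slitPlane := by
  rw [Complex.mem_slitPlane_iff] at hz ⊢
  rcases hz with h | h
  · left
    rw [Complex.add_re, Complex.ofReal_re]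
    linarith
  · right
    simpa using h

theorem add_natCast_mem_slitPlane {z : ℂ} (hz : z ∈ Complex.slitPlane) (n : ℕ) :
    z + (n : ℂ) ∈ Complex.slitPlane := by
  simpa using add_ofReal_mem_slitPlane hz n.cast_nonneg

/-- Euler's limit for the log-Gamma function. -/
theorem tendsto_logGamma {z : ℂ} (hz : z ∈ Complex.slitPlane) :
    Tendsto (fun N : ℕ => z * (Real.log N : ℂ) + (Real.log N.factorial : ℂ)
      - ∑ n ∈ Finset.range (N + 1), Complex.log (z + n)) atTop (𝓝 (logGamma z)) := by
  have h1 := ((summable_logGammaTerm z).hasSum.tendsto_sum_nat).const_add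
    (-(Real.eulerMascheroniConstant : ℂ) * z - Complex.log z)
  -- Replacing `γ` by `H_N - log N` makes the harmonic numbers cancel against the linear parts of
  -- the Weierstrass terms.
  have h2 : Tendsto (fun N : ℕ => (((harmonic N : ℝ) - Real.log N
      - Real.eulerMascheroniConstant : ℝ) : ℂ) * z) atTop (𝓝 0) := by
    have h := Real.tendsto_harmonic_sub_log.sub_const Real.eulerMascheroniConstant
    rw [sub_self] at h
    simpa using ((Complex.continuous_ofReal.tendsto _).comp h).mul_const z
  have h3 := h1.sub h2
  rw [sub_zero] at h3
  refine h3.congr fun N => ?_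
  have hsum : ∑ i ∈ Finset.range N, logGammaTerm z i = z * ((harmonic N : ℝ) : ℂ)
      - ∑ n ∈ Finset.range N, Complex.log (z + ((n + 1 : ℕ) : ℂ))
      + (Real.log N.factorial : ℂ) := by
    induction N with
    | zero => simp
    | succ N ih =>
      have hN : (0 : ℝ) < (N : ℝ) + 1 := by positivity
      have hlog : Complex.log (z + ((N + 1 : ℕ) : ℂ))
          = (Real.log ((N : ℝ) + 1) : ℂ) + Complex.log (1 + z / ((N : ℂ) + 1)) := by
        rw [← Complex.log_ofReal_mul hN (Complex.slitPlane_ne_zero (one_add_mem_slitPlane hz N))]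
        congr 1
        have : (N : ℂ) + 1 ≠ 0 := Nat.cast_add_one_ne_zero N
        push_cast
        field_simp
        ring
      rw [Finset.sum_range_succ, ih, Finset.sum_range_succ, hlog, harmonic_succ, logGammaTerm,
        Nat.factorial_succ, Nat.cast_mul, Real.log_mul (by positivity) (by positivity)]
      push_cast
      ring
  rw [hsum, Finset.sum_range_succ']
  push_cast
  ring_nf

theorem log_add_natCast {z : ℂ} {N : ℕ} (hN : N ≠ 0) (hz : 1 + z / (N : ℂ) ≠ 0) :
    Complex.log (z + N) = (Real.log N : ℂ) + Complex.log (1 + z / N) := by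
  have hN' : (0 : ℝ) < N := by exact_mod_cast Nat.pos_of_ne_zero hN
  rw [← Complex.log_ofReal_mul hN' hz]
  congr 1
  have : (N : ℂ) ≠ 0 := by exact_mod_cast hN
  push_cast
  field_simp
  ring

theorem one_add_div_natCast_ne_zero {z : ℂ} (hz : z ∈ Complex.slitPlane) {N : ℕ} (hN : N ≠ 0) :
    1 + z / (N : ℂ) ≠ 0 := by
  obtain ⟨m, rfl⟩ := Nat.exists_eq_succ_of_ne_zero hN
  simpa using Complex.slitPlane_ne_zero (one_add_mem_slitPlane hz m)

theorem tendsto_natCast_mul_log_one_add_div (z : ℂ) :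
    Tendsto (fun N : ℕ => (N : ℂ) * Complex.log (1 + z / N)) atTop (𝓝 z) := by
  refine Complex.tendsto_nat_mul_log_one_add_of_tendsto ?_
  refine tendsto_const_nhds.congr' ?_
  filter_upwards [eventually_ne_atTop 0] with N hN
  have : (N : ℂ) ≠ 0 := by exact_mod_cast hN
  field_simp

theorem tendsto_log_one_add_div (z : ℂ) :
    Tendsto (fun N : ℕ => Complex.log (1 + z / N)) atTop (𝓝 0) := by
  have h : Tendsto (fun N : ℕ => 1 + z / (N : ℂ)) atTop (𝓝 (1 + 0)) :=
    (tendsto_const_div_atTop_nhds_zero_nat z).const_add 1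
  rw [add_zero] at h
  have := h.clog (by simp)
  simpa using this

/-- The sums of logarithms in Euler's limit at `z` and `z + 1` differ by a shift of index. Each
logarithm is principal in both, so no branch has to be tracked. -/
theorem logGamma_add_one {z : ℂ} (hz : z ∈ Complex.slitPlane) :
    logGamma (z + 1) = logGamma z + Complex.log z := by
  have hz1 : z + 1 ∈ Complex.slitPlane := by simpa using add_natCast_mem_slitPlane hz 1
  have h := ((tendsto_logGamma hz).add_const (Complex.log z)).sub (tendsto_log_one_add_div (z + 1))
  rw [sub_zero] at h
  refine tendsto_nhds_unique (tendsto_logGamma hz1) (h.congr' ?_)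
  filter_upwards [eventually_ne_atTop 0] with N hN
  have h1 := log_add_natCast hN (one_add_div_natCast_ne_zero hz1 hN)
  have h2 : ∑ n ∈ Finset.range (N + 1), Complex.log (z + n) + Complex.log (z + 1 + N)
      = ∑ n ∈ Finset.range (N + 1), Complex.log (z + 1 + n) + Complex.log z := by
    have := Finset.sum_range_succ (fun n : ℕ => Complex.log (z + n)) (N + 1)
    rw [Finset.sum_range_succ'] at this
    push_cast at this
    simp only [add_zero] at this
    rw [show z + 1 + N = z + (N + 1) by ring, ← this]
    congr 1
    exact Finset.sum_congr rfl fun n _ => by rw [add_assoc, add_comm 1]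
  linear_combination -h2 + h1

theorem logGamma_add_natCast {z : ℂ} (hz : z ∈ Complex.slitPlane) (N : ℕ) :
    logGamma (z + N) = logGamma z + ∑ n ∈ Finset.range N, Complex.log (z + n) := by
  induction N with
  | zero => simp
  | succ N ih =>
    rw [Finset.sum_range_succ, ← add_assoc, ← ih, ← logGamma_add_one (add_natCast_mem_slitPlane hz N)]
    push_cast
    rw [add_assoc]

/-! ### The Stirling remainder vanishes along `z + N` -/

theorem tendsto_log_stirlingSeq :
    Tendsto (fun n : ℕ => Real.log (Stirling.stirlingSeq n)) atTop (𝓝 (Real.log Real.pi / 2)) := by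
  rw [← Real.log_sqrt Real.pi_pos.le]
  exact Stirling.tendsto_stirlingSeq_sqrt_pi.log (Real.sqrt_pos.mpr Real.pi_pos).ne'

theorem tendsto_stirlingTerm_add_natCast {j : ℕ} (hj : 1 ≤ j) (z : ℂ) :
    Tendsto (fun N : ℕ => stirlingTerm j (z + N)) atTop (𝓝 0) := by
  have h1 : Tendsto (fun N : ℕ => z + (N : ℂ)) atTop (Bornology.cobounded ℂ) :=
    (tendsto_const_add_cobounded z).comp tendsto_natCast_atTop_cobounded
  have h2 : Tendsto (fun N : ℕ => ((z + (N : ℂ))⁻¹) ^ (2 * j - 1)) atTop (𝓝 0) := by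
    have := (tendsto_inv₀_cobounded.comp h1).pow (2 * j - 1)
    rwa [zero_pow (by omega)] at this
  have h3 := h2.const_mul ((bernoulli (2 * j) : ℂ) / (2 * (j : ℂ) * (2 * (j : ℂ) - 1)))
  rw [mul_zero] at h3
  refine h3.congr fun N => ?_
  rw [stirlingTerm, inv_pow, ← div_eq_mul_inv, div_div]

/-- The boundary condition for the telescoping. Euler's limit reduces `ln Γ(z + N)` to `N!`, and
Stirling's formula for `N!` supplies the constant `½ log 2π`. Convergence along this one sequence,
for fixed `z`, is enough. -/
theorem tendsto_stirlingRemainder_add_natCast (k : ℕ) {z : ℂ} (hz : z ∈ Complex.slitPlane) :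
    Tendsto (fun N : ℕ => stirlingRemainder k (z + N)) atTop (𝓝 0) := by
  have hT : Tendsto (fun N : ℕ => ∑ j ∈ Finset.Ico 1 k, stirlingTerm j (z + N)) atTop (𝓝 0) := by
    have := tendsto_finsetSum (Finset.Ico 1 k) fun j hj =>
      tendsto_stirlingTerm_add_natCast (Finset.mem_Ico.mp hj).1 z
    simpa using this
  have hS : Tendsto (fun n : ℕ => (Real.log (Stirling.stirlingSeq n) : ℂ)) atTop
      (𝓝 ((Real.log Real.pi / 2 : ℝ) : ℂ)) :=
    (Complex.continuous_ofReal.tendsto _).comp tendsto_log_stirlingSeq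
  have hA := (tendsto_logGamma hz).const_sub (logGamma z)
  -- The product `(z + N + 1/2) log(1 + z/N)` is split. The half is `+1/2` because the sum in
  -- Euler's limit contains the extra term `log(z + N)`.
  have hL := ((tendsto_log_one_add_div z).const_mul (z + 1 / 2)).add
    (tendsto_natCast_mul_log_one_add_div z)
  have h := (((hA.add hS).sub hL).sub hT).add_const (z - ((Real.log Real.pi / 2 : ℝ) : ℂ))
  have h0 : logGamma z - logGamma z + ((Real.log Real.pi / 2 : ℝ) : ℂ)
      - ((z + 1 / 2) * 0 + z) - 0 + (z - ((Real.log Real.pi / 2 : ℝ) : ℂ)) = 0 := by ring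
  rw [h0] at h
  refine h.congr' ?_
  filter_upwards [eventually_ne_atTop 0] with N hN
  have hNr : (N : ℝ) ≠ 0 := by exact_mod_cast hN
  have h1 := log_add_natCast hN (one_add_div_natCast_ne_zero hz hN)
  have h2 : Real.log (Stirling.stirlingSeq N) = Real.log N.factorial
      - 1 / 2 * (Real.log 2 + Real.log N) - N * (Real.log N - 1) := by
    rw [Stirling.log_stirlingSeq_formula, Real.log_mul (by norm_num) hNr,
      Real.log_div hNr (Real.exp_pos 1).ne', Real.log_exp]
  have h3 : Complex.log (2 * (Real.pi : ℂ)) = (Real.log 2 : ℂ) + (Real.log Real.pi : ℂ) := by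
    rw [← Complex.ofReal_add, ← Real.log_mul (by norm_num) Real.pi_ne_zero,
      Complex.ofReal_log (by positivity)]
    push_cast
    rfl
  rw [stirlingRemainder, logGamma_add_natCast hz, h1, h2, h3, Finset.sum_range_succ, h1]
  push_cast
  ring

/-! ### Euler–Maclaurin on the unit interval -/

/-- The integral of `B_m(u) (z + u)^(-m)` over the unit interval. -/
noncomputable def bernoulliIntegral (m : ℕ) (z : ℂ) : ℂ :=
  ∫ u in (0 : ℝ)..1, (bernoulliFun m u : ℂ) * ((z + u) ^ m)⁻¹

theorem continuousOn_inv_add_pow {z : ℂ} (hz : z ∈ Complex.slitPlane) (m : ℕ) :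
    ContinuousOn (fun u : ℝ => ((z + u) ^ m)⁻¹) (Set.Ici 0) := by
  refine ContinuousOn.inv₀ (by fun_prop) fun u hu => ?_
  exact pow_ne_zero _ (Complex.slitPlane_ne_zero (add_ofReal_mem_slitPlane hz hu))

theorem uIcc_zero_one_subset_Ici : Set.uIcc (0 : ℝ) 1 ⊆ Set.Ici 0 := by
  rw [Set.uIcc_of_le zero_le_one]
  exact Set.Icc_subset_Ici_self

theorem bernoulliIntegral_one {z : ℂ} (hz : z ∈ Complex.slitPlane) :
    bernoulliIntegral 1 z = 1 - (z + 1 / 2) * (Complex.log (z + 1) - Complex.log z) := by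
  have hd : ∀ u ∈ Set.uIcc (0 : ℝ) 1, HasDerivAt
      (fun u : ℝ => (u : ℂ) - (z + 1 / 2) * Complex.log (z + u))
      ((bernoulliFun 1 u : ℂ) * ((z + u) ^ 1)⁻¹) u := by
    intro u hu
    have hu' := add_ofReal_mem_slitPlane hz (uIcc_zero_one_subset_Ici hu)
    have h1 : HasDerivAt (fun u : ℝ => (u : ℂ)) 1 u := Complex.ofRealCLM.hasDerivAt
    have h2 := (h1.sub (((h1.const_add z).clog_real hu').const_mul (z + 1 / 2)))
    convert! h2 using 1
    have := Complex.slitPlane_ne_zero hu'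
    rw [bernoulliFun_one, pow_one]
    push_cast
    field_simp
    ring
  rw [bernoulliIntegral, intervalIntegral.integral_eq_sub_of_hasDerivAt hd]
  · simp
    ring
  · refine ContinuousOn.intervalIntegrable (ContinuousOn.mul (by fun_prop) ?_)
    exact (continuousOn_inv_add_pow hz 1).mono uIcc_zero_one_subset_Ici

/-- Integration by parts with `B_{m+1}' = (m+1) B_m`. As `m + 1 ≥ 2`, `B_{m+1}` has equal values at
0 and 1, so the boundary term carries a single Bernoulli number. -/
theorem bernoulliIntegral_succ {z : ℂ} (hz : z ∈ Complex.slitPlane) {m : ℕ} (hm : 1 ≤ m) :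
    bernoulliIntegral m z / m = (bernoulli (m + 1) : ℂ) / (m * (m + 1))
      * (((z + 1) ^ m)⁻¹ - (z ^ m)⁻¹) + bernoulliIntegral (m + 1) z / (m + 1) := by
  have hm0 : (m : ℂ) ≠ 0 := by exact_mod_cast (by omega : m ≠ 0)
  have hm1 : (m : ℂ) + 1 ≠ 0 := Nat.cast_add_one_ne_zero m
  have hu : ∀ u ∈ Set.uIcc (0 : ℝ) 1, HasDerivAt (fun u : ℝ => ((z + u) ^ m)⁻¹)
      (-(m : ℂ) * ((z + u) ^ (m + 1))⁻¹) u := by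
    intro u hu
    have hne := Complex.slitPlane_ne_zero
      (add_ofReal_mem_slitPlane hz (uIcc_zero_one_subset_Ici hu))
    have h1 : HasDerivAt (fun u : ℝ => (u : ℂ)) 1 u := Complex.ofRealCLM.hasDerivAt
    have h2 := ((h1.const_add z).pow m).inv (pow_ne_zero m hne)
    convert! h2 using 1
    obtain ⟨p, rfl⟩ : ∃ p, m = p + 1 := ⟨m - 1, by omega⟩
    simp only [Nat.add_sub_cancel, mul_one, Pi.pow_apply]
    field_simp
    ring
  have hv : ∀ u ∈ Set.uIcc (0 : ℝ) 1, HasDerivAt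
      (fun u : ℝ => ((bernoulliFun (m + 1) u / (m + 1) : ℝ) : ℂ)) (bernoulliFun m u : ℂ) u :=
    fun u _ => (antideriv_bernoulliFun m u).ofReal_comp
  have h := intervalIntegral.integral_mul_deriv_eq_deriv_mul hu hv
    (ContinuousOn.intervalIntegrable
      ((continuousOn_const.mul (continuousOn_inv_add_pow hz (m + 1))).mono
        uIcc_zero_one_subset_Ici))
    (Continuous.intervalIntegrable (by fun_prop) _ _)
  have e1 : bernoulliIntegral m z
      = ∫ u in (0 : ℝ)..1, ((z + u) ^ m)⁻¹ * (bernoulliFun m u : ℂ) := by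
    rw [bernoulliIntegral]
    congr 1
    ext u
    ring
  have e2 : (∫ u in (0 : ℝ)..1, -(m : ℂ) * ((z + u) ^ (m + 1))⁻¹
      * ((bernoulliFun (m + 1) u / (m + 1) : ℝ) : ℂ))
      = -(m : ℂ) / (m + 1) * bernoulliIntegral (m + 1) z := by
    rw [bernoulliIntegral, ← intervalIntegral.integral_const_mul]
    congr 1
    ext u
    push_cast
    ring
  rw [e1, h, e2, bernoulliFun_endpoints_eq_of_ne_one (by omega), bernoulliFun_eval_zero]
  push_cast
  rw [add_zero]
  field_simp
  ring

theorem bernoulliIntegral_two_mul {z : ℂ} (hz : z ∈ Complex.slitPlane) {k : ℕ} (hk : 1 ≤ k) :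
    bernoulliIntegral (2 * k) z / (2 * k : ℕ)
      = bernoulliIntegral (2 * k + 1) z / (2 * k + 1 : ℕ) := by
  have hb : bernoulli (2 * k + 1) = 0 :=
    bernoulli_eq_zero_of_odd (odd_two_mul_add_one k) (by omega)
  rw [bernoulliIntegral_succ hz (by omega), hb]
  simp

theorem bernoulliIntegral_two_mul_sub_one {z : ℂ} (hz : z ∈ Complex.slitPlane) {k : ℕ}
    (hk : 1 ≤ k) : bernoulliIntegral (2 * k - 1) z / (2 * k - 1 : ℕ)
      = stirlingTerm k (z + 1) - stirlingTerm k z + bernoulliIntegral (2 * k) z / (2 * k : ℕ) := by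
  rw [bernoulliIntegral_succ hz (by omega), show 2 * k - 1 + 1 = 2 * k by omega, stirlingTerm,
    stirlingTerm]
  have hc : ((2 * k - 1 : ℕ) : ℂ) = 2 * (k : ℂ) - 1 := by
    rw [Nat.cast_sub (by omega)]
    push_cast
    ring
  have h1 : 2 * (k : ℂ) - 1 ≠ 0 := by rw [← hc]; exact_mod_cast (by omega : 2 * k - 1 ≠ 0)
  have h2 : (k : ℂ) ≠ 0 := by exact_mod_cast (by omega : k ≠ 0)
  have h3 := pow_ne_zero (2 * k - 1) (Complex.slitPlane_ne_zero hz)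
  have hz1 : z + 1 ∈ Complex.slitPlane := by simpa using add_natCast_mem_slitPlane hz 1
  have h4 := pow_ne_zero (2 * k - 1) (Complex.slitPlane_ne_zero hz1)
  rw [hc, sub_add_cancel]
  push_cast
  field_simp

theorem stirlingRemainder_succ {k : ℕ} (hk : 1 ≤ k) (z : ℂ) :
    stirlingRemainder (k + 1) z = stirlingRemainder k z - stirlingTerm k z := by
  rw [stirlingRemainder, stirlingRemainder, Finset.sum_Ico_succ_top hk]
  ring

/-- The even order `2k` is chosen because `B_{2k}(u)` is bounded on `[0, 1]` by its value at 0. -/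
theorem stirlingRemainder_succ_sub {z : ℂ} (hz : z ∈ Complex.slitPlane) {k : ℕ} (hk : 1 ≤ k) :
    stirlingRemainder (k + 1) z - stirlingRemainder (k + 1) (z + 1)
      = -(bernoulliIntegral (2 * k) z / (2 * k : ℕ)) := by
  -- The induction runs through odd orders, starting at order 1. One more integration by parts then
  -- lowers `2k + 1` to `2k` at no cost, as `B_{2k+1} = 0`.
  have key : ∀ k : ℕ, 1 ≤ k → stirlingRemainder k z - stirlingRemainder k (z + 1)
      = -(bernoulliIntegral (2 * k - 1) z / (2 * k - 1 : ℕ)) := by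
    intro k hk
    induction k, hk using Nat.le_induction with
    | base =>
      norm_num
      rw [stirlingRemainder, stirlingRemainder, bernoulliIntegral_one hz, logGamma_add_one hz]
      simp only [Finset.Ico_self, Finset.sum_empty]
      ring
    | succ k hk ih =>
      rw [show 2 * (k + 1) - 1 = 2 * k + 1 by omega, ← bernoulliIntegral_two_mul hz hk,
        stirlingRemainder_succ hk, stirlingRemainder_succ hk]
      linear_combination ih - bernoulliIntegral_two_mul_sub_one hz hk
  rw [key (k + 1) (by omega), show 2 * (k + 1) - 1 = 2 * k + 1 by omega,
    bernoulliIntegral_two_mul hz hk]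

/-! ### Wallis integrals -/

open MeasureTheory in
theorem integrableOn_inv_one_add_sq_pow {k : ℕ} (hk : 1 ≤ k) :
    IntegrableOn (fun u : ℝ => ((1 + u ^ 2) ^ k)⁻¹) (Set.Ioi 0) := by
  have h0 : ∀ u : ℝ, 0 < 1 + u ^ 2 := fun u => by positivity
  refine (integrable_inv_one_add_sq.integrableOn (s := Set.Ioi 0)).mono' ?_ ?_
  · refine Continuous.aestronglyMeasurable (Continuous.inv₀ (by fun_prop) fun u => ?_)
    exact (pow_pos (h0 u) k).ne'
  · refine Eventually.of_forall fun u => ?_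
    rw [Real.norm_of_nonneg (by positivity)]
    refine inv_anti₀ (h0 u) ?_
    exact le_self_pow₀ (by nlinarith [sq_nonneg u]) (by omega)

/-- The function `u (1 + u²)^{-k}` vanishes at 0 and at infinity, so its derivative integrates to
zero. -/
theorem integral_inv_one_add_sq_pow_succ {k : ℕ} (hk : 1 ≤ k) :
    2 * (k : ℝ) * ∫ u in Set.Ioi (0 : ℝ), ((1 + u ^ 2) ^ (k + 1))⁻¹
      = (2 * (k : ℝ) - 1) * ∫ u in Set.Ioi (0 : ℝ), ((1 + u ^ 2) ^ k)⁻¹ := by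
  have h0 : ∀ u : ℝ, 1 + u ^ 2 ≠ 0 := fun u => by positivity
  have hd : ∀ u ∈ Set.Ici (0 : ℝ), HasDerivAt (fun u : ℝ => u * ((1 + u ^ 2) ^ k)⁻¹)
      (2 * k * ((1 + u ^ 2) ^ (k + 1))⁻¹ - (2 * k - 1) * ((1 + u ^ 2) ^ k)⁻¹) u := by
    intro u _
    have h1 : HasDerivAt (fun u : ℝ => 1 + u ^ 2) (2 * u) u := by
      simpa using (hasDerivAt_pow 2 u).const_add 1
    have h2 := (hasDerivAt_id u).mul ((h1.pow k).inv (pow_ne_zero k (h0 u)))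
    convert! h2 using 1
    obtain ⟨p, rfl⟩ : ∃ p, k = p + 1 := ⟨k - 1, by omega⟩
    have := h0 u
    simp only [id, Pi.pow_apply, Pi.inv_apply, Nat.add_sub_cancel]
    field_simp
    ring
  have hlim : Tendsto (fun u : ℝ => u * ((1 + u ^ 2) ^ k)⁻¹) atTop (𝓝 0) := by
    refine squeeze_zero' ?_ ?_ tendsto_inv_atTop_zero
    · filter_upwards [eventually_ge_atTop 0] with u hu
      positivity
    · filter_upwards [eventually_gt_atTop 0] with u hu
      have h1 : 1 + u ^ 2 ≤ (1 + u ^ 2) ^ k :=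
        le_self_pow₀ (by nlinarith [sq_nonneg u]) (by omega)
      have h2 : 0 < (1 + u ^ 2) ^ k := by positivity
      rw [← div_eq_mul_inv, div_le_iff₀ h2, inv_mul_eq_div, le_div_iff₀ hu]
      nlinarith
  have hi1 := (integrableOn_inv_one_add_sq_pow (k := k + 1) (by omega)).const_mul (2 * (k : ℝ))
  have hi2 := (integrableOn_inv_one_add_sq_pow hk).const_mul (2 * (k : ℝ) - 1)
  have h := MeasureTheory.integral_Ioi_of_hasDerivAt_of_tendsto' hd (hi1.sub hi2) hlim
  rw [MeasureTheory.integral_sub hi1 hi2, MeasureTheory.integral_const_mul,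
    MeasureTheory.integral_const_mul] at h
  linarith

theorem sq_integral_inv_one_add_sq_pow (k : ℕ) :
    (∫ u in Set.Ioi (0 : ℝ), ((1 + u ^ 2) ^ (k + 1))⁻¹) ^ 2 * (Real.Wallis.W k * (2 * k + 1))
      = (Real.pi / 2) ^ 2 := by
  induction k with
  | zero => simp [Real.Wallis.W]
  | succ k ih =>
    have h := integral_inv_one_add_sq_pow_succ (k := k + 1) (by omega)
    push_cast at h
    rw [← ih, Real.Wallis.W_succ]
    generalize (∫ u in Set.Ioi (0 : ℝ), ((1 + u ^ 2) ^ (k + 1 + 1))⁻¹) = a at *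
    generalize (∫ u in Set.Ioi (0 : ℝ), ((1 + u ^ 2) ^ (k + 1))⁻¹) = b at *
    have hb : b = 2 * (k + 1) * a / (2 * k + 1) := by
      have : (2 : ℝ) * k + 1 ≠ 0 := by positivity
      field_simp
      linarith
    rw [hb]
    push_cast
    field_simp
    ring

/-- Lower bounds for Wallis' product bound the integral from above. The constant is sharp to leading
order, and it is what produces the final factor `1/2`. -/
theorem integral_inv_one_add_sq_pow_le {k : ℕ} (hk : 1 ≤ k) :
    (2 * (k : ℝ) - 1) * ∫ u in Set.Ioi (0 : ℝ), ((1 + u ^ 2) ^ k)⁻¹ ≤ √(Real.pi * k) := by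
  obtain ⟨p, rfl⟩ : ∃ p, k = p + 1 := ⟨k - 1, by omega⟩
  have h := sq_integral_inv_one_add_sq_pow p
  have hW := Real.Wallis.le_W p
  have hpi := Real.pi_pos
  refine Real.le_sqrt_of_sq_le ?_
  generalize (∫ u in Set.Ioi (0 : ℝ), ((1 + u ^ 2) ^ (p + 1))⁻¹) = a at *
  rw [div_mul_eq_mul_div, div_le_iff₀ (by positivity)] at hW
  have h1 : a ^ 2 * ((2 * p + 1) * (Real.pi / 2) * (2 * p + 1))
      ≤ a ^ 2 * (Real.Wallis.W p * (2 * p + 2) * (2 * p + 1)) := by gcongr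
  have h2 : a ^ 2 * (Real.Wallis.W p * (2 * p + 2) * (2 * p + 1))
      = (Real.pi / 2) ^ 2 * (2 * p + 2) := by rw [← h]; ring
  rw [h2] at h1
  push_cast
  have h3 : ((2 * ((p : ℝ) + 1) - 1) * a) ^ 2 * (Real.pi / 2)
      ≤ (Real.pi * (p + 1)) * (Real.pi / 2) := by linarith
  exact le_of_mul_le_mul_right h3 (by positivity)

theorem integral_inv_sq_add_sq_pow_le {k : ℕ} (hk : 1 ≤ k) {t : ℝ} (ht : 0 < t) {X : ℝ}
    (hX : 0 ≤ X) : (2 * (k : ℝ) - 1) * ∫ u in (0 : ℝ)..X, ((t ^ 2 + u ^ 2) ^ k)⁻¹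
      ≤ √(Real.pi * k) / t ^ (2 * k - 1) := by
  have hk' : (1 : ℝ) ≤ k := by exact_mod_cast hk
  have h1 : (∫ u in (0 : ℝ)..X, ((t ^ 2 + u ^ 2) ^ k)⁻¹)
      = (∫ u in (0 : ℝ)..(X / t), ((1 + u ^ 2) ^ k)⁻¹) / t ^ (2 * k - 1) := by
    have h2 : ∀ u : ℝ, ((t ^ 2 + u ^ 2) ^ k)⁻¹
        = (t ^ (2 * k))⁻¹ * ((1 + (u / t) ^ 2) ^ k)⁻¹ := by
      intro u
      rw [pow_mul, ← mul_inv, ← mul_pow]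
      congr 2
      field_simp
    simp_rw [h2]
    rw [intervalIntegral.integral_const_mul,
      intervalIntegral.integral_comp_div (fun v : ℝ => ((1 + v ^ 2) ^ k)⁻¹) ht.ne', zero_div,
      smul_eq_mul, show t ^ (2 * k) = t ^ (2 * k - 1) * t by
        rw [← pow_succ]; congr 1; omega]
    field_simp
  have h3 : (∫ u in (0 : ℝ)..(X / t), ((1 + u ^ 2) ^ k)⁻¹)
      ≤ ∫ u in Set.Ioi (0 : ℝ), ((1 + u ^ 2) ^ k)⁻¹ := by
    rw [intervalIntegral.integral_of_le (by positivity)]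
    refine MeasureTheory.setIntegral_mono_set (integrableOn_inv_one_add_sq_pow hk) ?_ ?_
    · exact Eventually.of_forall fun u => by positivity
    · exact Eventually.of_forall Set.Ioc_subset_Ioi_self
  rw [h1, ← mul_div_assoc]
  gcongr
  refine le_trans ?_ (integral_inv_one_add_sq_pow_le hk)
  exact mul_le_mul_of_nonneg_left h3 (by linarith)

/-! ### The Stirling remainder on the imaginary axis -/

/-- The Fourier series of `B_{2k}` is a cosine series whose coefficients all have one sign, so its
modulus is largest at `u = 0`. -/
theorem abs_bernoulliFun_two_mul_le {k : ℕ} (hk : 1 ≤ k) {u : ℝ} (hu : u ∈ Set.Icc (0 : ℝ) 1) :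
    |bernoulliFun (2 * k) u| ≤ |(bernoulli (2 * k) : ℝ)| := by
  have h0 := hasSum_one_div_nat_pow_mul_cos (k := k) (by omega) (x := 0) (by simp)
  have h1 := hasSum_one_div_nat_pow_mul_cos (k := k) (by omega) hu
  have hs := h0.summable
  simp only [mul_zero, Real.cos_zero, mul_one] at h0 hs
  have h2 : |∑' n : ℕ, 1 / (n : ℝ) ^ (2 * k) * Real.cos (2 * Real.pi * n * u)|
      ≤ ∑' n : ℕ, 1 / (n : ℝ) ^ (2 * k) := by
    rw [← Real.norm_eq_abs]
    refine tsum_of_norm_bounded hs.hasSum fun n => ?_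
    rw [norm_mul, Real.norm_of_nonneg (by positivity), Real.norm_eq_abs]
    exact mul_le_of_le_one_right (by positivity) (Real.abs_cos_le_one _)
  rw [h1.tsum_eq, h0.tsum_eq] at h2
  have h3 := h2.trans (le_abs_self _)
  rw [abs_mul, abs_mul] at h3
  have h4 : 0 < |(-1 : ℝ) ^ (k + 1) * (2 * Real.pi) ^ (2 * k) / 2 / ((2 * k).factorial : ℝ)| := by
    have := Real.pi_pos
    rw [abs_pos]
    have : (-1 : ℝ) ^ (k + 1) ≠ 0 := pow_ne_zero _ (by norm_num)
    positivity
  have h5 := le_of_mul_le_mul_left h3 h4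
  rw [← bernoulliFun_eval_zero]
  exact h5

theorem continuous_inv_sq_add_sq_pow {t : ℝ} (ht : 0 < t) (k : ℕ) :
    Continuous fun u : ℝ => ((t ^ 2 + u ^ 2) ^ k)⁻¹ :=
  Continuous.inv₀ (by fun_prop) fun u => by positivity

theorem norm_I_mul_add_pow (t u : ℝ) (k : ℕ) :
    ‖(Complex.I * t + u) ^ (2 * k)‖ = (t ^ 2 + u ^ 2) ^ k := by
  rw [norm_pow, pow_mul, ← Complex.normSq_eq_norm_sq, Complex.normSq_apply]
  congr 1
  simp
  ring

theorem norm_bernoulliIntegral_le {k : ℕ} (hk : 1 ≤ k) {t : ℝ} (ht : 0 < t) (n : ℕ) :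
    ‖bernoulliIntegral (2 * k) (Complex.I * t + n)‖
      ≤ |(bernoulli (2 * k) : ℝ)| * ∫ u in (n : ℝ)..(n + 1 : ℕ), ((t ^ 2 + u ^ 2) ^ k)⁻¹ := by
  have hc := continuous_inv_sq_add_sq_pow ht k
  have h1 : (∫ u in (n : ℝ)..(n + 1 : ℕ), ((t ^ 2 + u ^ 2) ^ k)⁻¹)
      = ∫ u in (0 : ℝ)..1, ((t ^ 2 + ((n : ℝ) + u) ^ 2) ^ k)⁻¹ := by
    rw [intervalIntegral.integral_comp_add_left (fun u : ℝ => ((t ^ 2 + u ^ 2) ^ k)⁻¹)]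
    simp
  rw [h1, ← intervalIntegral.integral_const_mul, bernoulliIntegral]
  refine intervalIntegral.norm_integral_le_of_norm_le zero_le_one ?_ ?_
  · refine Eventually.of_forall fun u hu => ?_
    have h2 : Complex.I * t + n + u = Complex.I * t + ((n + u : ℝ) : ℂ) := by
      push_cast
      ring
    rw [norm_mul, norm_inv, h2, norm_I_mul_add_pow, Complex.norm_real, Real.norm_eq_abs]
    exact mul_le_mul_of_nonneg_right (abs_bernoulliFun_two_mul_le hk ⟨hu.1.le, hu.2⟩)
      (by positivity)
  · have : Continuous fun u : ℝ => ((t ^ 2 + ((n : ℝ) + u) ^ 2) ^ k)⁻¹ := by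
      exact hc.comp (continuous_const.add continuous_id)
    exact (this.const_mul _).intervalIntegrable _ _

theorem I_mul_mem_slitPlane {t : ℝ} (ht : t ≠ 0) : Complex.I * (t : ℂ) ∈ Complex.slitPlane := by
  rw [Complex.mem_slitPlane_iff]
  right
  simpa using ht

/-- Stirling's approximation on the imaginary axis. -/
theorem norm_stirlingRemainder_I_mul_le {k : ℕ} (hk : 1 ≤ k) {t : ℝ} (ht : 0 < t) :
    ‖stirlingRemainder (k + 1) (Complex.I * t)‖
      ≤ |(bernoulli (2 * k) : ℝ)| * √(Real.pi * k) / (2 * k * (2 * k - 1) * t ^ (2 * k - 1)) := by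
  have hk' : (1 : ℝ) ≤ k := by exact_mod_cast hk
  have hk1 : (0 : ℝ) < 2 * k - 1 := by linarith
  have hz := I_mul_mem_slitPlane ht.ne'
  have hc := continuous_inv_sq_add_sq_pow ht k
  -- Telescoping joins the integrals over unit intervals into one over `[0, N]`. The far remainder
  -- disappears as `N → ∞`.
  have hb : ∀ N : ℕ, ‖stirlingRemainder (k + 1) (Complex.I * t)
      - stirlingRemainder (k + 1) (Complex.I * t + N)‖
      ≤ |(bernoulli (2 * k) : ℝ)| / (2 * k)
        * ∫ u in (0 : ℝ)..N, ((t ^ 2 + u ^ 2) ^ k)⁻¹ := by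
    intro N
    induction N with
    | zero => simp
    | succ N ih =>
      have h1 := stirlingRemainder_succ_sub (add_natCast_mem_slitPlane hz N) hk
      have h2 : Complex.I * t + ((N + 1 : ℕ) : ℂ) = Complex.I * t + N + 1 := by
        push_cast
        ring
      have h3 : ‖-(bernoulliIntegral (2 * k) (Complex.I * t + N) / (2 * k : ℕ))‖
          ≤ |(bernoulli (2 * k) : ℝ)| / (2 * k)
            * ∫ u in (N : ℝ)..(N + 1 : ℕ), ((t ^ 2 + u ^ 2) ^ k)⁻¹ := by
        rw [norm_neg, norm_div, Complex.norm_natCast, div_mul_eq_mul_div]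
        push_cast
        have := norm_bernoulliIntegral_le hk ht N
        push_cast at this
        gcongr
      rw [← intervalIntegral.integral_add_adjacent_intervals (b := (N : ℝ))
        (hc.intervalIntegrable _ _) (hc.intervalIntegrable _ _), mul_add, h2]
      refine le_trans ?_ (add_le_add ih h3)
      rw [← h1]
      refine le_trans (le_of_eq ?_) (norm_add_le _ _)
      congr 1
      ring
  have hlim := ((tendsto_stirlingRemainder_add_natCast (k + 1) hz).const_sub
    (stirlingRemainder (k + 1) (Complex.I * t))).norm
  rw [sub_zero] at hlim
  refine le_of_tendsto' hlim fun N => (hb N).trans ?_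
  have h4 := integral_inv_sq_add_sq_pow_le hk ht N.cast_nonneg
  have h5 : (∫ u in (0 : ℝ)..N, ((t ^ 2 + u ^ 2) ^ k)⁻¹)
      ≤ √(Real.pi * k) / t ^ (2 * k - 1) / (2 * k - 1) := by
    rw [le_div_iff₀ hk1]
    linarith
  calc _ ≤ |(bernoulli (2 * k) : ℝ)| / (2 * k)
        * (√(Real.pi * k) / t ^ (2 * k - 1) / (2 * k - 1)) := by gcongr
    _ = _ := by field_simp

/-! ### Duplication, reflection and the arctan term -/

/-- A continuous logarithm of `1` on a preconnected set that vanishes somewhere is zero. -/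
theorem eq_zero_of_exp_eq_one {X : Type*} [TopologicalSpace X] {s : Set X}
    (hs : IsPreconnected s) {f : X → ℂ} (hf : ContinuousOn f s)
    (hexp : ∀ x ∈ s, Complex.exp (f x) = 1) {x₀ : X} (hx₀ : x₀ ∈ s) (h₀ : f x₀ = 0) {x : X}
    (hx : x ∈ s) : f x = 0 := by
  have hpi : (2 * Real.pi * Complex.I : ℂ) ≠ 0 := Complex.two_pi_I_ne_zero
  have hc : ContinuousOn (fun x => (f x / (2 * Real.pi * Complex.I)).re) s :=
    Complex.continuous_re.comp_continuousOn (hf.div_const _)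
  -- The quotient `f / (2πi)` is an integer everywhere; a continuous map from a preconnected set to
  -- a discrete one is constant.
  have hmaps : Set.MapsTo (fun x => (f x / (2 * Real.pi * Complex.I)).re) s
      (Set.range ((↑) : ℤ → ℝ)) := by
    intro y hy
    obtain ⟨n, hn⟩ := Complex.exp_eq_one_iff.mp (hexp y hy)
    refine ⟨n, ?_⟩
    simp only [hn, mul_div_cancel_right₀ _ hpi, Complex.intCast_re]
  have hd : IsDiscrete (Set.range ((↑) : ℤ → ℝ)) :=
    Int.isClosedEmbedding_coe_real.isEmbedding.isInducing.isDiscrete_range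
  have h := hs.constant_of_mapsTo hd hc hmaps hx hx₀
  obtain ⟨n, hn⟩ := Complex.exp_eq_one_iff.mp (hexp x hx)
  simp only [h₀, hn, mul_div_cancel_right₀ _ hpi, Complex.intCast_re, zero_div,
    Complex.zero_re] at h
  rw [hn, show n = 0 by exact_mod_cast h]
  simp

theorem slitPlane_isPreconnected : IsPreconnected Complex.slitPlane :=
  (Complex.starConvex_one_slitPlane.isPathConnected
    Complex.one_mem_slitPlane).isConnected.isPreconnected

theorem continuousAt_logGamma {z : ℂ} (hz : z ∈ Complex.slitPlane) : ContinuousAt logGamma z :=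
  (differentiableOn_logGamma.differentiableAt (Complex.isOpen_slitPlane.mem_nhds hz)).continuousAt

theorem ofReal_mul_mem_slitPlane {r : ℝ} (hr : 0 < r) {z : ℂ} (hz : z ∈ Complex.slitPlane) :
    (r : ℂ) * z ∈ Complex.slitPlane := by
  rw [Complex.mem_slitPlane_iff] at hz ⊢
  rw [Complex.re_ofReal_mul, Complex.im_ofReal_mul]
  exact hz.imp (mul_pos hr) (mul_ne_zero hr.ne')

/-- The duplication formula for the log-Gamma function. -/
theorem logGamma_add_logGamma_add_half {z : ℂ} (hz : z ∈ Complex.slitPlane) :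
    logGamma z + logGamma (z + 1 / 2)
      = logGamma (2 * z) + (1 - 2 * z) * (Real.log 2 : ℂ) + (Real.log √Real.pi : ℂ) := by
  have hhalf : ∀ z ∈ Complex.slitPlane, z + 1 / 2 ∈ Complex.slitPlane := fun z hz => by
    simpa using add_ofReal_mem_slitPlane hz (u := 1 / 2) (by norm_num)
  have htwo : ∀ z ∈ Complex.slitPlane, 2 * z ∈ Complex.slitPlane := fun z hz => by
    simpa using ofReal_mul_mem_slitPlane (r := 2) (by norm_num) hz
  have hcont : ContinuousOn (fun z => logGamma z + logGamma (z + 1 / 2)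
      - (logGamma (2 * z) + (1 - 2 * z) * (Real.log 2 : ℂ) + (Real.log √Real.pi : ℂ)))
      Complex.slitPlane := by
    intro z hz
    refine ContinuousAt.continuousWithinAt (ContinuousAt.sub (ContinuousAt.add ?_ ?_)
      (ContinuousAt.add (ContinuousAt.add ?_ (by fun_prop)) continuousAt_const))
    · exact continuousAt_logGamma hz
    · exact ContinuousAt.comp (f := fun z : ℂ => z + 1 / 2) (continuousAt_logGamma (hhalf z hz))
        (by fun_prop)
    · exact ContinuousAt.comp (f := fun z : ℂ => 2 * z) (continuousAt_logGamma (htwo z hz))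
        (by fun_prop)
  have hpi : 0 < √Real.pi := Real.sqrt_pos.mpr Real.pi_pos
  have hexp : ∀ z ∈ Complex.slitPlane, Complex.exp (logGamma z + logGamma (z + 1 / 2)
      - (logGamma (2 * z) + (1 - 2 * z) * (Real.log 2 : ℂ) + (Real.log √Real.pi : ℂ))) = 1 := by
    intro z hz
    have h2 : Complex.exp ((1 - 2 * z) * (Real.log 2 : ℂ)) = (2 : ℂ) ^ (1 - 2 * z) := by
      rw [Complex.cpow_def_of_ne_zero (by norm_num), mul_comm,
        Complex.ofReal_log (by norm_num)]
      norm_num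
    rw [Complex.exp_sub, Complex.exp_add, Complex.exp_add, Complex.exp_add, exp_logGamma hz,
      exp_logGamma (hhalf z hz), exp_logGamma (htwo z hz), h2, ← Complex.ofReal_exp,
      Real.exp_log hpi, Complex.Gamma_mul_Gamma_add_half, div_self]
    refine mul_ne_zero (mul_ne_zero ?_ ?_) (by exact_mod_cast hpi.ne')
    · rw [← exp_logGamma (htwo z hz)]
      exact Complex.exp_ne_zero _
    · rw [← h2]
      exact Complex.exp_ne_zero _
  -- The branch is fixed at `z = 1/2`, where the identity reduces to `Γ(1/2) = √π`.
  have h0 : logGamma (1 / 2) + logGamma (1 / 2 + 1 / 2)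
      - (logGamma (2 * (1 / 2)) + (1 - 2 * (1 / 2)) * (Real.log 2 : ℂ)
        + (Real.log √Real.pi : ℂ)) = 0 := by
    have h1 := logGamma_ofReal (x := 1 / 2) (by norm_num)
    rw [Real.Gamma_one_half_eq] at h1
    norm_num at h1 ⊢
    rw [h1]
    ring
  have hmem : (1 / 2 : ℂ) ∈ Complex.slitPlane := by
    rw [Complex.mem_slitPlane_iff]
    left
    norm_num
  exact sub_eq_zero.mp (eq_zero_of_exp_eq_one slitPlane_isPreconnected hcont hexp hmem h0 hz)

theorem logGamma_conj {z : ℂ} (hz : z ∈ Complex.slitPlane) :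
    logGamma (starRingEnd ℂ z) = starRingEnd ℂ (logGamma z) := by
  have hterm : ∀ n, logGammaTerm (starRingEnd ℂ z) n = starRingEnd ℂ (logGammaTerm z n) := by
    intro n
    have harg := (Complex.mem_slitPlane_iff_arg.mp (one_add_mem_slitPlane hz n)).1
    rw [logGammaTerm, logGammaTerm, map_sub, ← Complex.log_conj _ harg]
    simp
  rw [logGamma, logGamma, tsum_congr hterm, map_add, map_sub, Complex.conj_tsum,
    Complex.log_conj _ (Complex.mem_slitPlane_iff_arg.mp hz).1]
  simp

theorem sin_pi_mul_critical (t : ℝ) :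
    Complex.sin (Real.pi * (Complex.I * t / 2 + 1 / 4))
      = ((√2 / 2 * Real.cosh (Real.pi * t / 2) : ℝ) : ℂ)
        + ((√2 / 2 * Real.sinh (Real.pi * t / 2) : ℝ) : ℂ) * Complex.I := by
  have h1 : (Real.pi * (Complex.I * t / 2 + 1 / 4) : ℂ)
      = ((Real.pi / 4 : ℝ) : ℂ) + ((Real.pi * t / 2 : ℝ) : ℂ) * Complex.I := by
    push_cast
    ring
  rw [h1, Complex.sin_add_mul_I, ← Complex.ofReal_sin, ← Complex.ofReal_cos,
    ← Complex.ofReal_cosh, ← Complex.ofReal_sinh, Real.sin_pi_div_four, Real.cos_pi_div_four]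
  push_cast
  ring

theorem sin_pi_mul_critical_re (t : ℝ) :
    (Complex.sin (Real.pi * (Complex.I * t / 2 + 1 / 4))).re
      = √2 / 2 * Real.cosh (Real.pi * t / 2) := by
  rw [sin_pi_mul_critical, Complex.add_re, Complex.ofReal_re, Complex.re_ofReal_mul, Complex.I_re,
    mul_zero, add_zero]

theorem sin_pi_mul_critical_im (t : ℝ) :
    (Complex.sin (Real.pi * (Complex.I * t / 2 + 1 / 4))).im
      = √2 / 2 * Real.sinh (Real.pi * t / 2) := by
  rw [sin_pi_mul_critical, Complex.add_im, Complex.ofReal_im, Complex.im_ofReal_mul, Complex.I_im,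
    mul_one, zero_add]

theorem sin_pi_mul_critical_re_pos (t : ℝ) :
    0 < (Complex.sin (Real.pi * (Complex.I * t / 2 + 1 / 4))).re := by
  rw [sin_pi_mul_critical_re]
  have := Real.cosh_pos (Real.pi * t / 2)
  positivity

theorem sin_pi_mul_critical_mem_slitPlane (t : ℝ) :
    Complex.sin (Real.pi * (Complex.I * t / 2 + 1 / 4)) ∈ Complex.slitPlane :=
  Complex.mem_slitPlane_iff.mpr (Or.inl (sin_pi_mul_critical_re_pos t))

/-- The reflection formula for the log-Gamma function on the line `Re z = 1/4`. -/
theorem logGamma_add_logGamma_one_sub (t : ℝ) :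
    logGamma (Complex.I * t / 2 + 1 / 4) + logGamma (1 - (Complex.I * t / 2 + 1 / 4))
      = (Real.log Real.pi : ℂ)
        - Complex.log (Complex.sin (Real.pi * (Complex.I * t / 2 + 1 / 4))) := by
  have hm1 : ∀ t : ℝ, Complex.I * t / 2 + 1 / 4 ∈ Complex.slitPlane := fun t => by
    rw [Complex.mem_slitPlane_iff]
    left
    norm_num
  have hm2 : ∀ t : ℝ, 1 - (Complex.I * t / 2 + 1 / 4) ∈ Complex.slitPlane := fun t => by
    rw [Complex.mem_slitPlane_iff]
    left
    norm_num
  -- Only the line `Re z = 1/4` is considered: there `sin(πz)` has positive real part, so its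
  -- principal logarithm is continuous.
  have hcont : ContinuousOn (fun t : ℝ => logGamma (Complex.I * t / 2 + 1 / 4)
      + logGamma (1 - (Complex.I * t / 2 + 1 / 4)) - ((Real.log Real.pi : ℂ)
        - Complex.log (Complex.sin (Real.pi * (Complex.I * t / 2 + 1 / 4))))) Set.univ := by
    intro t _
    refine ContinuousAt.continuousWithinAt (ContinuousAt.sub (ContinuousAt.add ?_ ?_)
      (ContinuousAt.sub continuousAt_const ?_))
    · exact ContinuousAt.comp (f := fun t : ℝ => Complex.I * t / 2 + 1 / 4)
        (continuousAt_logGamma (hm1 t)) (by fun_prop)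
    · exact ContinuousAt.comp (f := fun t : ℝ => 1 - (Complex.I * t / 2 + 1 / 4))
        (continuousAt_logGamma (hm2 t)) (by fun_prop)
    · exact ContinuousAt.clog (by fun_prop) (sin_pi_mul_critical_mem_slitPlane t)
  have hpi : (Real.pi : ℂ) ≠ 0 := by exact_mod_cast Real.pi_ne_zero
  have hexp : ∀ t : ℝ, t ∈ Set.univ → Complex.exp (logGamma (Complex.I * t / 2 + 1 / 4)
      + logGamma (1 - (Complex.I * t / 2 + 1 / 4)) - ((Real.log Real.pi : ℂ)
        - Complex.log (Complex.sin (Real.pi * (Complex.I * t / 2 + 1 / 4))))) = 1 := by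
    intro t _
    have hs := Complex.slitPlane_ne_zero (sin_pi_mul_critical_mem_slitPlane t)
    rw [Complex.exp_sub, Complex.exp_add, Complex.exp_sub, exp_logGamma (hm1 t),
      exp_logGamma (hm2 t), Complex.exp_log hs, ← Complex.ofReal_exp, Real.exp_log Real.pi_pos,
      Complex.Gamma_mul_Gamma_one_sub, div_self (div_ne_zero hpi hs)]
  have h0 : logGamma (Complex.I * (0 : ℝ) / 2 + 1 / 4)
      + logGamma (1 - (Complex.I * (0 : ℝ) / 2 + 1 / 4)) - ((Real.log Real.pi : ℂ)
        - Complex.log (Complex.sin (Real.pi * (Complex.I * (0 : ℝ) / 2 + 1 / 4)))) = 0 := by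
    have e1 : Complex.I * ((0 : ℝ) : ℂ) / 2 + 1 / 4 = ((1 / 4 : ℝ) : ℂ) := by
      push_cast
      ring
    have hsin : 0 < Real.sin (Real.pi * (1 / 4)) :=
      Real.sin_pos_of_pos_of_lt_pi (by positivity) (by linarith [Real.pi_pos])
    rw [e1, ← Complex.ofReal_one, ← Complex.ofReal_sub, logGamma_ofReal (by norm_num),
      logGamma_ofReal (by norm_num), ← Complex.ofReal_mul, ← Complex.ofReal_sin,
      ← Complex.ofReal_log hsin.le, ← Complex.ofReal_add, ← Complex.ofReal_sub,
      ← Real.log_mul (Real.Gamma_pos_of_pos (by norm_num)).ne'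
        (Real.Gamma_pos_of_pos (by norm_num)).ne', Real.Gamma_mul_Gamma_one_sub,
      Real.log_div Real.pi_ne_zero hsin.ne', sub_self]
  exact sub_eq_zero.mp
    (eq_zero_of_exp_eq_one isPreconnected_univ hcont hexp (Set.mem_univ 0) h0 (Set.mem_univ t))

/-- With `q = e^{-2y}`, `tanh y = (1 - q)/(1 + q)`, which is the tangent of `arctan 1 - arctan q`.
-/
theorem arctan_tanh (y : ℝ) :
    Real.arctan (Real.sinh y / Real.cosh y)
      = Real.pi / 4 - Real.arctan (Real.exp (-(2 * y))) := by
  have he := Real.exp_pos (-(2 * y))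
  have h1 : Real.sinh y / Real.cosh y
      = (1 - Real.exp (-(2 * y))) / (1 + Real.exp (-(2 * y))) := by
    have h2 : Real.exp (-y) = Real.exp y * Real.exp (-(2 * y)) := by
      rw [← Real.exp_add]
      congr 1
      ring
    rw [Real.sinh_eq, Real.cosh_eq, h2]
    have := Real.exp_pos y
    field_simp
  rw [h1, eq_sub_iff_add_eq, Real.arctan_add, ← Real.arctan_one]
  · congr 1
    field_simp
    rw [div_eq_one_iff_eq (by nlinarith)]
    ring
  · rw [div_mul_eq_mul_div, div_lt_one (by positivity)]
    nlinarith

theorem im_log_sin_pi_mul_critical (t : ℝ) :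
    (Complex.log (Complex.sin (Real.pi * (Complex.I * t / 2 + 1 / 4)))).im
      = Real.pi / 4 - Real.arctan (Real.exp (-Real.pi * t)) := by
  have h2 : (0 : ℝ) < √2 / 2 := by positivity
  have h3 : Real.exp (-Real.pi * t) = Real.exp (-(2 * (Real.pi * t / 2))) := by
    congr 1
    ring
  have harg := abs_lt.mp
    (Complex.abs_arg_lt_pi_div_two_iff.mpr (Or.inl (sin_pi_mul_critical_re_pos t)))
  rw [Complex.log_im, h3, ← arctan_tanh, ← mul_div_mul_left _ _ h2.ne',
    ← sin_pi_mul_critical_re, ← sin_pi_mul_critical_im, ← Complex.tan_arg,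
    Real.arctan_tan (by linarith) harg.2]

/-- The argument of Gamma on the line `Re z = 1/4` in terms of the imaginary axis. -/
theorem im_logGamma_critical {t : ℝ} (ht : 0 < t) :
    2 * (logGamma (Complex.I * t / 2 + 1 / 4)).im
      = (logGamma (2 * (Complex.I * t))).im - (logGamma (Complex.I * t)).im
        - 3 * t * Real.log 2 - Real.pi / 4 + Real.arctan (Real.exp (-Real.pi * t)) := by
  have hm1 : Complex.I * t / 2 + 1 / 4 ∈ Complex.slitPlane := by
    rw [Complex.mem_slitPlane_iff]
    left
    norm_num
  have hm2 : Complex.I * t / 2 + 1 / 4 + 1 / 2 ∈ Complex.slitPlane := by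
    rw [Complex.mem_slitPlane_iff]
    left
    norm_num
  -- Here `h1` gives the sum of the arguments at real parts 1/4 and 3/4, `h2` rewrites it through
  -- `it` and `2it`, and `h3` gives their difference once `1 - z` is recognised as a conjugate.
  have h1 := congrArg Complex.im (logGamma_add_logGamma_add_half hm1)
  have h2 := congrArg Complex.im (logGamma_add_logGamma_add_half (I_mul_mem_slitPlane ht.ne'))
  have h3 := congrArg Complex.im (logGamma_add_logGamma_one_sub t)
  have h4 : 1 - (Complex.I * t / 2 + 1 / 4)
      = starRingEnd ℂ (Complex.I * t / 2 + 1 / 4 + 1 / 2) := by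
    apply Complex.ext
    · rw [Complex.conj_re]
      norm_num
    · rw [Complex.conj_im]
      norm_num
  rw [h4, logGamma_conj hm2, Complex.sub_im, im_log_sin_pi_mul_critical] at h3
  rw [show 2 * (Complex.I * t / 2 + 1 / 4) = Complex.I * t + 1 / 2 by ring] at h1
  have e2 : (2 * (Complex.I * (t : ℂ))).im = 2 * t := by simp
  have e3 : (1 / 2 : ℂ).im = 0 := by norm_num
  simp only [Complex.add_im, Complex.conj_im, Complex.im_mul_ofReal, Complex.ofReal_im,
    Complex.I_im, one_mul, Complex.sub_im, Complex.one_im, e2, e3] at h1 h2 h3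
  linarith

/-! ### The exact formula for theta -/

theorem abs_bernoulli_two_mul {j : ℕ} (hj : 1 ≤ j) :
    |(bernoulli (2 * j) : ℝ)| = (-1) ^ (j + 1) * (bernoulli (2 * j) : ℝ) := by
  have h := hasSum_zeta_nat (k := j) (by omega)
  have h0 := h.nonneg fun n => by positivity
  have h1 : 0 ≤ (-1 : ℝ) ^ (j + 1) * (bernoulli (2 * j) : ℝ) := by
    have hp : 0 < (2 : ℝ) ^ (2 * j - 1) * Real.pi ^ (2 * j) / ((2 * j).factorial : ℝ) := by
      have := Real.pi_pos
      positivity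
    refine nonneg_of_mul_nonneg_left ?_ hp
    refine h0.trans (le_of_eq ?_)
    ring
  rw [← abs_of_nonneg h1, abs_mul, abs_pow, abs_neg, abs_one, one_pow, one_mul]

/-- Three signs cancel: `(-1)^{j+1}` from `B_{2j}`, `(-1)^j` from `i^{-(2j-1)}`, and the negative
factor `2^{1-2j} - 1`. Hence absolute values may be summed in the expansion of theta. -/
theorem im_gaussTerm_I_mul {j : ℕ} (hj : 1 ≤ j) {t : ℝ} (ht : 0 < t) :
    (gaussTerm j (Complex.I * t)).im = 2 * thetaTerm j t := by
  have hj' : (1 : ℝ) ≤ j := by exact_mod_cast hj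
  have ht' : (t : ℂ) ≠ 0 := by exact_mod_cast ht.ne'
  have hj0 : (j : ℂ) ≠ 0 := by exact_mod_cast (by omega : j ≠ 0)
  have hj1 : 2 * (j : ℂ) - 1 ≠ 0 := by
    have : (2 * (j : ℝ) - 1) ≠ 0 := by linarith
    exact_mod_cast this
  have hI : (Complex.I ^ (2 * j - 1))⁻¹ = (-1) ^ j * Complex.I := by
    obtain ⟨p, rfl⟩ : ∃ p, j = p + 1 := ⟨j - 1, by omega⟩
    rw [show 2 * (p + 1) - 1 = 2 * p + 1 by omega, pow_succ, pow_mul, Complex.I_sq, mul_inv,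
      Complex.inv_I, pow_succ, ← inv_pow]
    norm_num
  have h1 : gaussTerm j (Complex.I * t) = ((2 * thetaTerm j t : ℝ) : ℂ) * Complex.I := by
    have hT : ∀ c : ℂ, stirlingTerm j (c * (Complex.I * t)) = (bernoulli (2 * j) : ℂ)
        / (2 * (j : ℂ) * (2 * (j : ℂ) - 1)) * (c ^ (2 * j - 1))⁻¹ * ((-1) ^ j * Complex.I)
        * ((t : ℂ) ^ (2 * j - 1))⁻¹ := by
      intro c
      rw [stirlingTerm, ← hI, mul_pow, mul_pow, div_eq_mul_inv, div_eq_mul_inv]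
      simp only [mul_inv]
      ring
    have h2 := hT 1
    rw [one_mul] at h2
    rw [gaussTerm, hT, h2, thetaTerm_eq hj ht, abs_bernoulli_two_mul hj]
    push_cast
    rw [pow_succ (-1 : ℂ) j, one_pow]
    field_simp
    ring
  rw [h1]
  simp

theorem log_I_mul {t : ℝ} (ht : 0 < t) :
    Complex.log (Complex.I * t) = (Real.log t : ℂ) + Real.pi / 2 * Complex.I := by
  rw [mul_comm, Complex.log_ofReal_mul ht Complex.I_ne_zero, Complex.log_I]

/-- The Riemann-Siegel theta function as its approximation plus the remainder. -/
theorem theta_eq (k : ℕ) {t : ℝ} (ht : 0 < t) :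
    theta t = thetaApproxArctan k t + thetaRemainder (k + 1) t := by
  have hG := im_logGamma_critical ht
  have hsum : ∑ j ∈ Finset.Ico 1 (k + 1), (gaussTerm j (Complex.I * t)).im
      = 2 * ∑ j ∈ Finset.Icc 1 k, thetaTerm j t := by
    rw [Finset.mul_sum]
    refine Finset.sum_congr (by ext; simp) fun j hj => ?_
    exact im_gaussTerm_I_mul (Finset.mem_Icc.mp hj).1 ht
  have hlog2 : Complex.log (2 * (Complex.I * t))
      = (Real.log 2 : ℂ) + ((Real.log t : ℂ) + Real.pi / 2 * Complex.I) := by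
    rw [← log_I_mul ht, ← Complex.log_ofReal_mul (by norm_num)
      (Complex.slitPlane_ne_zero (I_mul_mem_slitPlane ht.ne'))]
    norm_num
  -- In `R(2z) - R(z)` the terms `-½ log z` cancel, so the elementary part contributes no multiple
  -- of `π` to the imaginary part; the `-π/8` comes from reflection alone.
  have hR : gaussRemainder (k + 1) (Complex.I * t)
      = logGamma (2 * (Complex.I * t)) - logGamma (Complex.I * t)
        - ((t * Real.log t + 2 * t * Real.log 2 - t : ℝ) : ℂ) * Complex.I
        + ((1 / 2 * Real.log 2 + Real.pi / 2 * t : ℝ) : ℂ)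
        - ∑ j ∈ Finset.Ico 1 (k + 1), gaussTerm j (Complex.I * t) := by
    simp only [gaussRemainder, stirlingRemainder, gaussTerm, Finset.sum_sub_distrib, hlog2,
      log_I_mul ht]
    push_cast
    linear_combination (-(t : ℂ) * Real.pi / 2) * Complex.I_sq
  have hRi := congrArg Complex.im hR
  rw [Complex.sub_im, Complex.add_im, Complex.sub_im, Complex.sub_im, Complex.ofReal_im,
    Complex.im_ofReal_mul, Complex.I_im, Complex.im_sum, hsum] at hRi
  have hrem : thetaRemainder (k + 1) t = 1 / 2 * (gaussRemainder (k + 1) (Complex.I * t)).im := by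
    rw [thetaRemainder]
    simp
  have hl : Real.log (t / (2 * Real.pi * Real.exp 1))
      = Real.log t - (Real.log 2 + Real.log Real.pi + 1) := by
    rw [Real.log_div ht.ne' (by positivity), Real.log_mul (by positivity) (Real.exp_pos 1).ne',
      Real.log_mul (by norm_num) Real.pi_ne_zero, Real.log_exp]
  rw [theta, thetaApproxArctan, thetaApprox, hrem, hRi, hl]
  linear_combination (1 / 2) * hG

/-! ### Ratio of consecutive terms and the smallest term -/

/-- The Dirichlet eta function at `2 k`. -/
noncomputable def etaEven (k : ℕ) : ℝ :=
  (1 - 1 / 2 ^ (2 * k - 1)) * ∑' n : ℕ, 1 / (n : ℝ) ^ (2 * k)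

theorem one_div_pow_le_one_div_pow {m n : ℕ} (hm : 1 ≤ m) (hmn : m ≤ n) (p : ℕ) :
    1 / (n : ℝ) ^ p ≤ 1 / (m : ℝ) ^ p := by
  have hm' : (0 : ℝ) < m := by exact_mod_cast hm
  gcongr

/-- Splitting `ζ(2k)` by parity exhibits `etaEven` as the alternating series `1 - 4^{-k} + ⋯` with
decreasing terms, which lies between its first two partial sums. -/
theorem etaEven_mem_Icc {k : ℕ} (hk : 1 ≤ k) : etaEven k ∈ Set.Icc (1 - 1 / 4 ^ k : ℝ) 1 := by
  set f : ℕ → ℝ := fun n => 1 / (n : ℝ) ^ (2 * k) with hf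
  have hs : Summable f := Real.summable_one_div_nat_pow.mpr (by omega)
  have hsub : ∀ a b : ℕ, a ≠ 0 → Summable fun n => f (a * n + b) := fun a b ha =>
    hs.comp_injective fun m n h => by simpa [ha] using h
  have h4 : (2 : ℝ) ^ (2 * k) = 4 ^ k := by rw [pow_mul]; norm_num
  have heven : ∑' n, f (2 * n) = (∑' n, f n) / 4 ^ k := by
    rw [← tsum_div_const]
    refine tsum_congr fun n => ?_
    simp only [hf]
    rw [Nat.cast_mul, mul_pow, Nat.cast_ofNat, h4]
    field_simp
  have hsplit := tsum_even_add_odd (f := f) (hsub 2 0 two_ne_zero) (hsub 2 1 two_ne_zero)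
  have heta : etaEven k = ∑' n, f (2 * n + 1) - ∑' n, f (2 * n) := by
    have h2 : (2 : ℝ) ^ (2 * k - 1) * 2 = 4 ^ k := by
      rw [← h4, ← pow_succ]
      congr 1
      omega
    have h3 : ∑' n, f (2 * n + 1) = ∑' n, f n - (∑' n, f n) / 4 ^ k := by
      rw [← heven]
      linarith
    rw [h3, heven, etaEven, ← h2]
    have : (2 : ℝ) ^ (2 * k - 1) ≠ 0 := by positivity
    change (1 - 1 / (2 : ℝ) ^ (2 * k - 1)) * (∑' n, f n) = _
    field_simp
    ring
  -- The sum starts at `n = 0`, where `1 / 0 = 0` makes the term vanish.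
  have hf0 : f 0 = 0 := by simp [hf, show k ≠ 0 by omega]
  have hf1 : f 1 = 1 := by simp [hf]
  have hf2 : f 2 = 1 / 4 ^ k := by simp [hf, h4]
  have ho := (hsub 2 1 two_ne_zero).tsum_eq_zero_add
  have he := (hsub 2 0 two_ne_zero).tsum_eq_zero_add
  have he' := (hsub 2 2 two_ne_zero).tsum_eq_zero_add
  simp only [mul_zero, zero_add, add_zero, hf0, hf1, hf2, mul_add, mul_one, add_assoc] at ho he he'
  norm_num at ho he he'
  have hle1 : ∑' n, f (2 * n + 3) ≤ ∑' n, f (2 * n + 2) :=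
    (hsub 2 3 two_ne_zero).tsum_le_tsum
      (fun n => one_div_pow_le_one_div_pow (by omega) (by omega) _) (hsub 2 2 two_ne_zero)
  have hle2 : ∑' n, f (2 * n + 4) ≤ ∑' n, f (2 * n + 3) :=
    (hsub 2 4 two_ne_zero).tsum_le_tsum
      (fun n => one_div_pow_le_one_div_pow (by omega) (by omega) _) (hsub 2 3 two_ne_zero)
  rw [heta, ho, he]
  constructor
  · rw [he', one_div]
    linarith
  · linarith

/-- A much weaker rational bound, enough for comparison with the polynomial `2k(2k-1)`. -/
theorem div_add_one_le_etaEven {k : ℕ} (hk : 1 ≤ k) : (k : ℝ) / (k + 1) ≤ etaEven k := by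
  refine le_trans ?_ (etaEven_mem_Icc hk).1
  have h1 : (k : ℝ) + 1 ≤ 4 ^ k := by
    have : k < 4 ^ k := Nat.lt_pow_self (by norm_num)
    exact_mod_cast this
  have h2 : 1 / (4 : ℝ) ^ k ≤ 1 / (k + 1) := by gcongr
  have h3 : (k : ℝ) / (k + 1) = 1 - 1 / (k + 1) := by
    field_simp
    ring
  linarith

theorem etaEven_pos {k : ℕ} (hk : 1 ≤ k) : 0 < etaEven k := by
  refine lt_of_lt_of_le ?_ (div_add_one_le_etaEven hk)
  have : (0 : ℝ) < k := by exact_mod_cast hk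
  positivity

theorem thetaTerm_eq_etaEven {k : ℕ} (hk : 1 ≤ k) {t : ℝ} (ht : 0 < t) :
    thetaTerm k t = etaEven k * ((2 * k - 2).factorial : ℝ)
      / ((2 * Real.pi) ^ (2 * k) * t ^ (2 * k - 1)) := by
  have hz := (hasSum_zeta_nat (k := k) (by omega)).tsum_eq
  have habs := abs_bernoulli_two_mul hk
  obtain ⟨p, rfl⟩ : ∃ p, k = p + 1 := ⟨k - 1, by omega⟩
  have hB : |(bernoulli (2 * (p + 1)) : ℝ)|
      = (∑' n : ℕ, 1 / (n : ℝ) ^ (2 * (p + 1))) * ((2 * (p + 1)).factorial : ℝ)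
        / (2 ^ (2 * (p + 1) - 1) * Real.pi ^ (2 * (p + 1))) := by
    rw [hz, habs]
    have := Real.pi_pos
    field_simp
  have hfac : ((2 * (p + 1)).factorial : ℝ)
      = (2 * p + 2) * ((2 * p + 1) * ((2 * p).factorial : ℝ)) := by
    rw [show 2 * (p + 1) = 2 * p + 1 + 1 by ring, Nat.factorial_succ, Nat.factorial_succ]
    push_cast
    ring
  rw [thetaTerm_eq hk ht, hB, etaEven, hfac, mul_pow,
    show 2 * (p + 1) - 2 = 2 * p by omega, show 2 * (p + 1) - 1 = 2 * p + 1 by omega]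
  have := Real.pi_pos
  push_cast
  have h1 : 2 * ((p : ℝ) + 1) - 1 = 2 * p + 1 := by ring
  rw [h1, show 2 * (p + 1) = 2 * p + 2 by ring]
  generalize (∑' n : ℕ, 1 / (n : ℝ) ^ (2 * p + 2)) = s
  field_simp
  ring

theorem thetaTerm_pos {k : ℕ} (hk : 1 ≤ k) {t : ℝ} (ht : 0 < t) : 0 < thetaTerm k t := by
  rw [thetaTerm_eq_etaEven hk ht]
  have := Real.pi_pos
  have := etaEven_pos hk
  positivity

theorem thetaTerm_succ {k : ℕ} (hk : 1 ≤ k) {t : ℝ} (ht : 0 < t) :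
    etaEven k * (2 * Real.pi * t) ^ 2 * thetaTerm (k + 1) t
      = etaEven (k + 1) * (2 * k * (2 * k - 1)) * thetaTerm k t := by
  rw [thetaTerm_eq_etaEven hk ht, thetaTerm_eq_etaEven (by omega) ht]
  obtain ⟨p, rfl⟩ : ∃ p, k = p + 1 := ⟨k - 1, by omega⟩
  rw [show 2 * (p + 1 + 1) - 2 = 2 * p + 1 + 1 by omega, show 2 * (p + 1) - 2 = 2 * p by omega,
    show 2 * (p + 1 + 1) - 1 = 2 * p + 3 by omega, show 2 * (p + 1) - 1 = 2 * p + 1 by omega,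
    Nat.factorial_succ, Nat.factorial_succ]
  have := Real.pi_pos
  push_cast
  field_simp
  ring

theorem thetaTerm_le_succ_iff {k : ℕ} (hk : 1 ≤ k) {t : ℝ} (ht : 0 < t) :
    thetaTerm k t ≤ thetaTerm (k + 1) t
      ↔ etaEven k * (2 * Real.pi * t) ^ 2 ≤ etaEven (k + 1) * (2 * k * (2 * k - 1)) := by
  have h := thetaTerm_succ hk ht
  have h0 := thetaTerm_pos hk ht
  have hpi := Real.pi_pos
  have he := etaEven_pos hk
  have hc : 0 < etaEven k * (2 * Real.pi * t) ^ 2 := by positivity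
  rw [← mul_le_mul_iff_right₀ hc, h]
  exact mul_le_mul_iff_left₀ h0

/-- Unimodality: the growth of `2k(2k-1)` outweighs the variation of `etaEven`, so terms that have
stopped decreasing never decrease again. A first local minimum is therefore global. -/
theorem thetaTerm_le_succ_succ {k : ℕ} (hk : 1 ≤ k) {t : ℝ} (ht : 0 < t)
    (h : thetaTerm k t ≤ thetaTerm (k + 1) t) :
    thetaTerm (k + 1) t ≤ thetaTerm (k + 2) t := by
  rw [thetaTerm_le_succ_iff hk ht] at h
  refine (thetaTerm_le_succ_iff (by omega) ht).mpr ?_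
  have hk' : (1 : ℝ) ≤ k := by exact_mod_cast hk
  have h0 := etaEven_pos hk
  have h1 := (etaEven_mem_Icc (k := k + 1) (by omega)).2
  have h1' := etaEven_pos (k := k + 1) (by omega)
  have hb0 := div_add_one_le_etaEven hk
  have hb2 := div_add_one_le_etaEven (k := k + 2) (by omega)
  push_cast at hb2 ⊢
  have h3 : (k : ℝ) / (k + 1) * ((k + 2) / (k + 2 + 1)) ≤ etaEven k * etaEven (k + 2) := by
    gcongr
  have h4 : 2 * k * (2 * k - 1)
      ≤ (k : ℝ) / (k + 1) * ((k + 2) / (k + 2 + 1)) * (2 * (k + 1) * (2 * (k + 1) - 1)) := by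
    field_simp
    nlinarith
  have h5 : (k : ℝ) / (k + 1) * ((k + 2) / (k + 2 + 1)) * (2 * (k + 1) * (2 * (k + 1) - 1))
      ≤ etaEven k * etaEven (k + 2) * (2 * (k + 1) * (2 * (k + 1) - 1)) :=
    mul_le_mul_of_nonneg_right h3 (by nlinarith)
  refine le_of_mul_le_mul_left ?_ h0
  calc etaEven k * (etaEven (k + 1) * (2 * Real.pi * t) ^ 2)
      = etaEven (k + 1) * (etaEven k * (2 * Real.pi * t) ^ 2) := by ring
    _ ≤ etaEven (k + 1) * (etaEven (k + 1) * (2 * k * (2 * k - 1))) := by gcongr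
    _ = (etaEven (k + 1) * etaEven (k + 1)) * (2 * k * (2 * k - 1)) := by ring
    _ ≤ 1 * (2 * k * (2 * k - 1)) :=
        mul_le_mul_of_nonneg_right (mul_le_one₀ h1 h1'.le h1) (by nlinarith)
    _ ≤ etaEven k * (etaEven (k + 2) * (2 * (k + 1) * (2 * (k + 1) - 1))) := by linarith

theorem exists_thetaTerm_le_succ {t : ℝ} (ht : 0 < t) :
    ∃ k : ℕ, 1 ≤ k ∧ thetaTerm k t ≤ thetaTerm (k + 1) t := by
  obtain ⟨k, hk⟩ := exists_nat_ge ((2 * Real.pi * t) ^ 2 + 1)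
  have hpi := Real.pi_pos
  have hx : 0 < (2 * Real.pi * t) ^ 2 := by positivity
  have hk1 : (1 : ℝ) ≤ k := by linarith
  have hk' : 1 ≤ k := by exact_mod_cast hk1
  refine ⟨k, hk', (thetaTerm_le_succ_iff hk' ht).mpr ?_⟩
  have h1 := (etaEven_mem_Icc hk').2
  have h2 := div_add_one_le_etaEven (k := k + 1) (by omega)
  have h3 : (1 : ℝ) / 2 ≤ (k + 1 : ℕ) / ((k + 1 : ℕ) + 1) := by
    push_cast
    rw [div_le_div_iff₀ (by norm_num) (by positivity)]
    linarith
  calc etaEven k * (2 * Real.pi * t) ^ 2 ≤ 1 * (2 * Real.pi * t) ^ 2 := by gcongr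
    _ ≤ 1 / 2 * (2 * (k : ℝ) * (2 * k - 1)) := by nlinarith
    _ ≤ etaEven (k + 1) * (2 * k * (2 * k - 1)) :=
        mul_le_mul_of_nonneg_right (h3.trans h2) (by nlinarith)

theorem isLeast_kMin {t : ℝ} (ht : 0 < t) :
    IsLeast {k : ℕ | 1 ≤ k ∧ thetaTerm k t ≤ thetaTerm (k + 1) t} (kMin t) :=
  ⟨Nat.sInf_mem (exists_thetaTerm_le_succ ht), fun _ h => Nat.sInf_le h⟩

theorem one_le_kMin {t : ℝ} (ht : 0 < t) : 1 ≤ kMin t := (isLeast_kMin ht).1.1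

theorem thetaTerm_succ_lt_of_lt_kMin {t : ℝ} (ht : 0 < t) {k : ℕ} (hk : 1 ≤ k)
    (hlt : k < kMin t) : thetaTerm (k + 1) t < thetaTerm k t := by
  by_contra! h
  exact absurd ((isLeast_kMin ht).2 ⟨hk, h⟩) (by omega)

theorem thetaTerm_kMin_le {t : ℝ} (ht : 0 < t) {j : ℕ} (hj : 1 ≤ j) :
    thetaTerm (kMin t) t ≤ thetaTerm j t := by
  have hK := (isLeast_kMin ht).1
  rcases le_total (kMin t) j with h | h
  · have key : ∀ j, kMin t ≤ j → thetaTerm (kMin t) t ≤ thetaTerm j t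
        ∧ thetaTerm j t ≤ thetaTerm (j + 1) t := by
      intro j hj
      induction j, hj using Nat.le_induction with
      | base => exact ⟨le_rfl, hK.2⟩
      | succ j hj ih =>
        exact ⟨ih.1.trans ih.2, thetaTerm_le_succ_succ (hK.1.trans hj) ht ih.2⟩
    exact (key j h).1
  · induction h using Nat.decreasingInduction with
    | self => exact le_rfl
    | of_succ j hlt ih =>
      exact (ih (by omega)).trans (thetaTerm_succ_lt_of_lt_kMin ht hj hlt).le

/-- The term ratio is at least 1 at `kMin t` and less than 1 just before it. With `etaEven` squeezed
between `k/(k+1)` and 1, each fact confines `kMin t` from one side. -/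
theorem abs_kMin_sub_le {t : ℝ} (ht : 0 < t) : |(kMin t : ℝ) - Real.pi * t| ≤ 2 := by
  have hpi := Real.pi_pos
  have hpt : 0 < Real.pi * t := by positivity
  have hK1 := one_le_kMin ht
  have hK2 := (isLeast_kMin ht).1.2
  rw [abs_le]
  constructor
  · rw [thetaTerm_le_succ_iff hK1 ht] at hK2
    generalize kMin t = K at *
    have hK : (1 : ℝ) ≤ K := by exact_mod_cast hK1
    have h1 := div_add_one_le_etaEven hK1
    have h2 := (etaEven_mem_Icc (k := K + 1) (by omega)).2
    have h3 : (K : ℝ) / (K + 1) * (2 * Real.pi * t) ^ 2 ≤ 2 * K * (2 * K - 1) := by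
      calc _ ≤ etaEven K * (2 * Real.pi * t) ^ 2 := by gcongr
        _ ≤ _ := hK2
        _ ≤ 1 * (2 * K * (2 * K - 1)) := mul_le_mul_of_nonneg_right h2 (by nlinarith)
        _ = _ := one_mul _
    rw [div_mul_eq_mul_div, div_le_iff₀ (by linarith)] at h3
    have h4 : (2 * Real.pi * t) ^ 2 ≤ 2 * (2 * K - 1) * (K + 1) :=
      le_of_mul_le_mul_left (by linarith) (show (0 : ℝ) < K by linarith)
    have h5 : 2 * Real.pi * t ≤ 2 * K + 1 :=
      le_of_sq_le_sq (by nlinarith) (by linarith)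
    linarith
  -- If `kMin t = 1` there is no preceding ratio, but the upper bound is then trivial.
  · rcases hK1.eq_or_lt with h | h
    · rw [← h]
      push_cast
      linarith
    · obtain ⟨k, hk⟩ : ∃ k, kMin t = k + 1 := ⟨kMin t - 1, by omega⟩
      have hk1 : 1 ≤ k := by omega
      have hlt := thetaTerm_succ_lt_of_lt_kMin ht hk1 (by omega)
      rw [← not_le, thetaTerm_le_succ_iff hk1 ht, not_le] at hlt
      rw [hk]
      have hk' : (1 : ℝ) ≤ k := by exact_mod_cast hk1
      have h1 := div_add_one_le_etaEven (k := k + 1) (by omega)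
      have h2 := (etaEven_mem_Icc hk1).2
      push_cast at h1 ⊢
      have h3 : ((k : ℝ) + 1) / (k + 1 + 1) * (2 * k * (2 * k - 1)) ≤ (2 * Real.pi * t) ^ 2 := by
        calc _ ≤ etaEven (k + 1) * (2 * k * (2 * k - 1)) :=
              mul_le_mul_of_nonneg_right h1 (by nlinarith)
          _ ≤ _ := hlt.le
          _ ≤ 1 * (2 * Real.pi * t) ^ 2 := by gcongr
          _ = _ := one_mul _
      rw [div_mul_eq_mul_div, div_le_iff₀ (by linarith)] at h3
      have h4 : (2 * k - 2) ^ 2 * ((k : ℝ) + 1 + 1) ≤ (2 * Real.pi * t) ^ 2 * (k + 1 + 1) := by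
        nlinarith
      have h5 : 2 * k - 2 ≤ 2 * Real.pi * t :=
        le_of_sq_le_sq (le_of_mul_le_mul_right h4 (by linarith)) (by linarith)
      linarith

/-! ### Asymptotics of terms and remainder near `k = πt` -/

/-- An effective rate for Stirling's formula: the increments are at most `1/(12m(m+1))`, which
telescopes. -/
theorem log_stirlingSeq_mem_Icc {n : ℕ} (hn : 1 ≤ n) :
    Real.log (Stirling.stirlingSeq n) - Real.log Real.pi / 2 ∈ Set.Icc (0 : ℝ) (1 / (12 * n)) := by
  have hn' : (0 : ℝ) < n := by exact_mod_cast hn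
  constructor
  · rw [sub_nonneg, ← Real.log_sqrt Real.pi_pos.le]
    exact Real.log_le_log (Real.sqrt_pos.mpr Real.pi_pos)
      (Stirling.sqrt_pi_le_stirlingSeq (by omega))
  · have key : ∀ m : ℕ, n ≤ m → Real.log (Stirling.stirlingSeq n)
        - Real.log (Stirling.stirlingSeq m) ≤ 1 / (12 * n) - 1 / (12 * m) := by
      intro m hm
      induction m, hm using Nat.le_induction with
      | base => simp
      | succ m hm ih =>
        have hm' : (0 : ℝ) < m := by exact_mod_cast hn.trans hm
        have h := Stirling.log_stirlingSeq_sdiff_le m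
        have h2 : 1 / (12 * (m : ℝ) * (m + 1)) = 1 / (12 * m) - 1 / (12 * (m + 1)) := by
          field_simp
          ring
        push_cast
        linarith
    refine le_of_tendsto (tendsto_log_stirlingSeq.const_sub _) ?_
    filter_upwards [eventually_ge_atTop n] with m hm
    have : (0 : ℝ) ≤ 1 / (12 * m) := by positivity
    linarith [key m hm]

section OneAddIsBigO

variable {α : Type*} {l : Filter α} {g f h : α → ℝ}

theorem mul_sub_one_isBigO (hg : Tendsto g l (𝓝 0)) (hf : (fun x => f x - 1) =O[l] g)
    (hh : (fun x => h x - 1) =O[l] g) : (fun x => f x * h x - 1) =O[l] g := by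
  have h1 : (fun x => (f x - 1) * (h x - 1)) =O[l] g := by
    simpa using (hf.trans_tendsto hg).isBigO_one ℝ |>.mul hh
  refine ((h1.add hf).add hh).congr_left fun x => ?_
  ring

theorem comp_sub_isBigO (hg : Tendsto g l (𝓝 0)) {φ : ℝ → ℝ} {a : ℝ}
    (hφ : DifferentiableAt ℝ φ a) (hf : (fun x => f x - a) =O[l] g) :
    (fun x => φ (f x) - φ a) =O[l] g := by
  have ht : Tendsto f l (𝓝 a) := tendsto_sub_nhds_zero_iff.mp (hf.trans_tendsto hg)
  exact (hφ.isBigO_sub.comp_tendsto ht).trans hf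

theorem exp_sub_one_isBigO (hg : Tendsto g l (𝓝 0)) (hf : f =O[l] g) :
    (fun x => Real.exp (f x) - 1) =O[l] g := by
  simpa using comp_sub_isBigO hg (φ := Real.exp) (a := 0) (by fun_prop) (by simpa using hf)

theorem inv_sub_one_isBigO (hg : Tendsto g l (𝓝 0)) (hf : (fun x => f x - 1) =O[l] g) :
    (fun x => (f x)⁻¹ - 1) =O[l] g := by
  simpa using comp_sub_isBigO hg (φ := fun y => y⁻¹) (a := 1)
    (differentiableAt_inv one_ne_zero) hf

theorem sqrt_sub_one_isBigO (hg : Tendsto g l (𝓝 0)) (hf : (fun x => f x - 1) =O[l] g) :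
    (fun x => √(f x) - 1) =O[l] g := by
  simpa using comp_sub_isBigO hg (φ := Real.sqrt) (a := 1)
    (Real.hasDerivAt_sqrt one_ne_zero).differentiableAt hf

end OneAddIsBigO

/-- The filter of `t → ∞` with `|k - π t| ≤ A`. -/
def nearLine (A : ℝ) : Filter (ℝ × ℕ) :=
  comap Prod.fst atTop ⊓ 𝓟 {p | |(p.2 : ℝ) - Real.pi * p.1| ≤ A}

variable {A : ℝ}

/-- Asymptotics along this filter of pairs are exactly the estimates in `t` that are uniform in `k`.
-/
theorem eventually_nearLine {P : ℝ × ℕ → Prop} :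
    (∀ᶠ p in nearLine A, P p) ↔ ∃ t₀ : ℝ, ∀ t : ℝ, t₀ ≤ t → ∀ k : ℕ,
      |(k : ℝ) - Real.pi * t| ≤ A → P (t, k) := by
  rw [nearLine, eventually_inf_principal, eventually_comap, eventually_atTop]
  constructor
  · rintro ⟨t₀, h⟩
    exact ⟨t₀, fun t ht k hk => h t ht (t, k) rfl hk⟩
  · rintro ⟨t₀, h⟩
    refine ⟨t₀, ?_⟩
    rintro t ht ⟨t', k⟩ rfl hk
    exact h t' ht k hk

theorem tendsto_fst_nearLine : Tendsto Prod.fst (nearLine A) atTop :=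
  tendsto_comap.mono_left inf_le_left

theorem tendsto_inv_fst_nearLine : Tendsto (fun p : ℝ × ℕ => p.1⁻¹) (nearLine A) (𝓝 0) :=
  tendsto_inv_atTop_zero.comp tendsto_fst_nearLine

theorem eventually_nearLine_bounds : ∀ᶠ p in nearLine A,
    1 ≤ p.1 ∧ p.1 ≤ p.2 ∧ 1 ≤ p.2 ∧ |(p.2 : ℝ) - Real.pi * p.1| ≤ A := by
  refine eventually_nearLine.mpr ⟨max 1 A, fun t ht k hk => ?_⟩
  have h1 := le_of_max_le_left ht
  have h2 := le_of_max_le_right ht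
  have h3 := (abs_le.mp hk).1
  have h4 := Real.pi_gt_three
  have h5 : t ≤ k := by nlinarith
  refine ⟨h1, h5, ?_, hk⟩
  exact_mod_cast h1.trans h5

theorem isBigO_inv_fst {f : ℝ × ℕ → ℝ} (c : ℝ)
    (h : ∀ t : ℝ, ∀ k : ℕ, 1 ≤ t → t ≤ k → 1 ≤ k → |(k : ℝ) - Real.pi * t| ≤ A →
      |f (t, k)| ≤ c / t) : f =O[nearLine A] fun p => p.1⁻¹ := by
  refine IsBigO.of_bound c ?_
  filter_upwards [eventually_nearLine_bounds (A := A)] with p hp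
  have ht : 0 < p.1 := by linarith [hp.1]
  rw [Real.norm_eq_abs, Real.norm_eq_abs, abs_of_pos (inv_pos.mpr ht),
    ← div_eq_mul_inv]
  exact h p.1 p.2 hp.1 hp.2.1 hp.2.2.1 hp.2.2.2

theorem ratio_sub_one_isBigO :
    (fun p : ℝ × ℕ => p.2 / (Real.pi * p.1) - 1) =O[nearLine A] fun p => p.1⁻¹ := by
  refine isBigO_inv_fst A fun t k ht _ _ hk => ?_
  have hpi := Real.pi_gt_three
  have h1 : k / (Real.pi * t) - 1 = (k - Real.pi * t) / (Real.pi * t) := by field_simp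
  have hA := (abs_nonneg _).trans hk
  rw [h1, abs_div, abs_of_pos (show 0 < Real.pi * t by positivity)]
  gcongr
  nlinarith

theorem ratio_sub_half_sub_one_isBigO :
    (fun p : ℝ × ℕ => (2 * p.2 - 1) / (2 * Real.pi * p.1) - 1) =O[nearLine A]
      fun p => p.1⁻¹ := by
  have h := (ratio_sub_one_isBigO (A := A)).sub
    (isBigO_refl (fun p : ℝ × ℕ => p.1⁻¹) (nearLine A) |>.const_mul_left (2 * Real.pi)⁻¹)
  refine h.congr' ?_ EventuallyEq.rfl
  filter_upwards [eventually_nearLine_bounds (A := A)] with p hp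
  have : p.1 ≠ 0 := by linarith [hp.1]
  have := Real.pi_pos
  field_simp
  ring

theorem etaEven_sub_one_isBigO :
    (fun p : ℝ × ℕ => etaEven p.2 - 1) =O[nearLine A] fun p => p.1⁻¹ := by
  refine isBigO_inv_fst 1 fun t k ht htk hk _ => ?_
  have h1 := div_add_one_le_etaEven hk
  have h2 := (etaEven_mem_Icc hk).2
  rw [abs_of_nonpos (by linarith)]
  have h3 : (k : ℝ) / (k + 1) = 1 - 1 / (k + 1) := by
    field_simp
    ring
  have h4 : 1 / ((k : ℝ) + 1) ≤ 1 / t := by gcongr; linarith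
  simp only
  linarith

theorem inv_two_pow_isBigO :
    (fun p : ℝ × ℕ => (1 : ℝ) / 2 ^ (2 * p.2 - 1)) =O[nearLine A] fun p => p.1⁻¹ := by
  refine isBigO_inv_fst 1 fun t k ht htk hk _ => ?_
  have h1 : (k : ℝ) ≤ 2 ^ (2 * k - 1) := by
    have h2 : k < 2 ^ k := Nat.lt_pow_self (by norm_num)
    have h3 : 2 ^ k ≤ 2 ^ (2 * k - 1) := Nat.pow_le_pow_right (by norm_num) (by omega)
    exact_mod_cast h2.le.trans h3
  rw [abs_of_nonneg (by positivity)]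
  gcongr
  exact htk.trans h1

theorem stirlingSeq_sub_one_isBigO :
    (fun p : ℝ × ℕ => Real.exp (Real.log (Stirling.stirlingSeq (2 * p.2)) - Real.log Real.pi / 2)
      - 1) =O[nearLine A] fun p => p.1⁻¹ := by
  refine exp_sub_one_isBigO tendsto_inv_fst_nearLine (isBigO_inv_fst 1 fun t k ht htk hk _ => ?_)
  have h := log_stirlingSeq_mem_Icc (n := 2 * k) (by omega)
  rw [abs_of_nonneg h.1]
  refine h.2.trans ?_
  push_cast
  gcongr
  linarith

/-- With `x = πt`, the exponent vanishes to second order at `k = x`: the bounds `1 - 1/r ≤ log r ≤ r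
- 1` place it between 0 and `2(k - x)²/x`. This is why every `k = πt + O(1)` gives the same leading
term. -/
theorem power_sub_one_isBigO :
    (fun p : ℝ × ℕ => Real.exp (2 * p.2 * Real.log (p.2 / (Real.pi * p.1))
      + 2 * Real.pi * p.1 - 2 * p.2) - 1) =O[nearLine A] fun p => p.1⁻¹ := by
  refine exp_sub_one_isBigO tendsto_inv_fst_nearLine
    (isBigO_inv_fst (2 * A ^ 2) fun t k ht htk hk hA => ?_)
  have hpi := Real.pi_gt_three
  have hk' : (0 : ℝ) < k := by exact_mod_cast hk
  have hx : 0 < Real.pi * t := by positivity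
  have hr : 0 < k / (Real.pi * t) := by positivity
  have h1 := Real.log_le_sub_one_of_pos hr
  have h2 := Real.one_sub_inv_le_log_of_pos hr
  have h3 : 0 ≤ 2 * k * Real.log (k / (Real.pi * t)) + 2 * Real.pi * t - 2 * k := by
    have : 2 * k * (1 - (k / (Real.pi * t))⁻¹) = 2 * k - 2 * Real.pi * t := by field_simp
    nlinarith
  have h4 : 2 * k * Real.log (k / (Real.pi * t)) + 2 * Real.pi * t - 2 * k
      ≤ 2 * (k - Real.pi * t) ^ 2 / (Real.pi * t) := by
    have : 2 * k * (k / (Real.pi * t) - 1) + 2 * Real.pi * t - 2 * k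
        = 2 * (k - Real.pi * t) ^ 2 / (Real.pi * t) := by
      field_simp
      ring
    rw [← this]
    gcongr
  rw [abs_of_nonneg h3]
  refine h4.trans ?_
  rw [← sq_abs]
  gcongr
  nlinarith

/-- An exact factorisation in which each factor after the main term is `1 + O(1/t)` along
`nearLine`. -/
theorem thetaTerm_eq_mul {k : ℕ} (hk : 1 ≤ k) {t : ℝ} (ht : 0 < t) :
    thetaTerm k t = Real.exp (-2 * Real.pi * t) / (2 * Real.pi * √t)
      * (etaEven k
        * Real.exp (Real.log (Stirling.stirlingSeq (2 * k)) - Real.log Real.pi / 2)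
        * Real.exp (2 * k * Real.log (k / (Real.pi * t)) + 2 * Real.pi * t - 2 * k)
        * √(k / (Real.pi * t)) * (k / (Real.pi * t))⁻¹
        * ((2 * k - 1) / (2 * Real.pi * t))⁻¹) := by
  have hpi := Real.pi_pos
  have hk' : (1 : ℝ) ≤ k := by exact_mod_cast hk
  have hk0 : (0 : ℝ) < k := by linarith
  have hk1 : (0 : ℝ) < 2 * k - 1 := by linarith
  obtain ⟨p, hp⟩ : ∃ p, k = p + 1 := ⟨k - 1, by omega⟩
  have hS : 0 < Stirling.stirlingSeq (2 * k) := by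
    rw [show 2 * k = 2 * p + 1 + 1 by omega]
    exact Stirling.stirlingSeq'_pos _
  have e1 : Real.exp (Real.log (Stirling.stirlingSeq (2 * k)) - Real.log Real.pi / 2)
      = Stirling.stirlingSeq (2 * k) / √Real.pi := by
    rw [Real.exp_sub, Real.exp_log hS, ← Real.log_sqrt hpi.le,
      Real.exp_log (Real.sqrt_pos.mpr hpi)]
  have e2 : Real.exp (2 * k * Real.log (k / (Real.pi * t)) + 2 * Real.pi * t - 2 * k)
      = (k / (Real.pi * t)) ^ (2 * k) * Real.exp (2 * Real.pi * t) / Real.exp 1 ^ (2 * k) := by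
    rw [Real.exp_sub, Real.exp_add, ← Real.exp_nat_mul, mul_one]
    congr 2
    · rw [mul_comm, Real.exp_mul, Real.exp_log (by positivity), ← Real.rpow_natCast]
      push_cast
      rfl
    · push_cast
      rfl
  have e3 : ((2 * k).factorial : ℝ) = (2 * k) * (2 * k - 1) * ((2 * k - 2).factorial : ℝ) := by
    rw [hp, show 2 * (p + 1) - 2 = 2 * p by omega, show 2 * (p + 1) = 2 * p + 1 + 1 by ring,
      Nat.factorial_succ, Nat.factorial_succ]
    push_cast
    ring
  have e4 : √(2 * ((2 * k : ℕ) : ℝ)) = 2 * √k := by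
    rw [show (2 * ((2 * k : ℕ) : ℝ)) = 2 ^ 2 * (k : ℝ) by push_cast; ring,
      Real.sqrt_mul (by norm_num), Real.sqrt_sq (by norm_num)]
  have e5 : √(k / (Real.pi * t)) = √k / (√Real.pi * √t) := by
    rw [Real.sqrt_div hk0.le, Real.sqrt_mul hpi.le]
  have e6 : Real.exp (-2 * Real.pi * t) = (Real.exp (2 * Real.pi * t))⁻¹ := by
    rw [← Real.exp_neg]
    congr 1
    ring
  have e7 : t ^ (2 * k) = t ^ (2 * k - 1) * t := by
    rw [← pow_succ]
    congr 1
    omega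
  rw [thetaTerm_eq_etaEven hk ht, e1, e2, e5, e6, Stirling.stirlingSeq, e3, e4]
  push_cast
  simp only [div_pow, mul_pow]
  rw [e7]
  have h1 : 0 < √t := Real.sqrt_pos.mpr ht
  have h2 : 0 < √Real.pi := Real.sqrt_pos.mpr hpi
  have h3 : 0 < √(k : ℝ) := Real.sqrt_pos.mpr hk0
  field_simp
  rw [Real.sq_sqrt ht.le, Real.sq_sqrt hpi.le]
  ring

theorem thetaTerm_div_sub_one_isBigO :
    (fun p : ℝ × ℕ => thetaTerm p.2 p.1
      / (Real.exp (-2 * Real.pi * p.1) / (2 * Real.pi * √p.1)) - 1) =O[nearLine A]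
      fun p => p.1⁻¹ := by
  have hg := tendsto_inv_fst_nearLine (A := A)
  have hr := ratio_sub_one_isBigO (A := A)
  have h := mul_sub_one_isBigO hg (mul_sub_one_isBigO hg (mul_sub_one_isBigO hg
    (mul_sub_one_isBigO hg (mul_sub_one_isBigO hg etaEven_sub_one_isBigO
      stirlingSeq_sub_one_isBigO) power_sub_one_isBigO) (sqrt_sub_one_isBigO hg hr))
      (inv_sub_one_isBigO hg hr)) (inv_sub_one_isBigO hg ratio_sub_half_sub_one_isBigO)
  refine h.congr' ?_ EventuallyEq.rfl
  filter_upwards [eventually_nearLine_bounds (A := A)] with p hp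
  have ht : 0 < p.1 := by linarith [hp.1]
  have hpi := Real.pi_pos
  have : 0 < √p.1 := Real.sqrt_pos.mpr ht
  rw [thetaTerm_eq_mul hp.2.2.1 ht, mul_div_cancel_left₀]
  positivity

/-- The remainders at `it` and `2it` are bounded separately, which gives `1 + 2^{1-2k}` where the
term has `1 - 2^{1-2k}`; the last factor is their quotient. -/
theorem abs_thetaRemainder_succ_le {k : ℕ} (hk : 1 ≤ k) {t : ℝ} (ht : 0 < t) :
    |thetaRemainder (k + 1) t| ≤ √(Real.pi * k) * thetaTerm k t
      * ((1 + 1 / 2 ^ (2 * k - 1)) * (1 - 1 / 2 ^ (2 * k - 1))⁻¹) := by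
  have hk' : (1 : ℝ) ≤ k := by exact_mod_cast hk
  have hk1 : (0 : ℝ) < 2 * k - 1 := by linarith
  have hp : (2 : ℝ) ≤ 2 ^ (2 * k - 1) := le_self_pow₀ (by norm_num) (by omega)
  have h1 := norm_stirlingRemainder_I_mul_le hk ht
  have h2 := norm_stirlingRemainder_I_mul_le hk (t := 2 * t) (by positivity)
  have h3 : Complex.I * ((2 * t : ℝ) : ℂ) = 2 * (Complex.I * t) := by
    push_cast
    ring
  rw [h3, mul_pow] at h2
  have h4 : |thetaRemainder (k + 1) t| ≤ 1 / 2 * (‖stirlingRemainder (k + 1) (2 * (Complex.I * t))‖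
      + ‖stirlingRemainder (k + 1) (Complex.I * t)‖) := by
    rw [thetaRemainder, gaussRemainder]
    refine (Complex.abs_im_le_norm _).trans ?_
    rw [norm_mul]
    refine mul_le_mul (by norm_num) (norm_sub_le _ _) (norm_nonneg _) (by norm_num)
  refine h4.trans ((mul_le_mul_of_nonneg_left (add_le_add h2 h1) (by norm_num)).trans
    (le_of_eq ?_))
  rw [thetaTerm_eq hk ht]
  generalize (2 : ℝ) ^ (2 * k - 1) = c at *
  have hc : c - 1 ≠ 0 := by linarith
  have hc0 : c ≠ 0 := by linarith
  have hc1 : 1 - 1 / c = (c - 1) / c := by field_simp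
  rw [hc1]
  field_simp
  ring

theorem exists_abs_thetaRemainder_le : ∃ m : ℝ × ℕ → ℝ,
    ((fun p => m p - 1) =O[nearLine A] fun p => p.1⁻¹) ∧
    ∀ᶠ p in nearLine A, |thetaRemainder (p.2 + 1) p.1|
      ≤ 1 / 2 * Real.exp (-2 * Real.pi * p.1) * m p := by
  have hg := tendsto_inv_fst_nearLine (A := A)
  have hq := inv_two_pow_isBigO (A := A)
  refine ⟨fun p => √(p.2 / (Real.pi * p.1)) * (thetaTerm p.2 p.1
      / (Real.exp (-2 * Real.pi * p.1) / (2 * Real.pi * √p.1)))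
    * ((1 + 1 / 2 ^ (2 * p.2 - 1)) * (1 - 1 / 2 ^ (2 * p.2 - 1))⁻¹), ?_, ?_⟩
  · refine mul_sub_one_isBigO hg (mul_sub_one_isBigO hg
      (sqrt_sub_one_isBigO hg ratio_sub_one_isBigO) thetaTerm_div_sub_one_isBigO)
      (mul_sub_one_isBigO hg (by simpa using hq) (inv_sub_one_isBigO hg ?_))
    simpa using hq.neg_left
  · filter_upwards [eventually_nearLine_bounds (A := A)] with p hp
    have ht : 0 < p.1 := by linarith [hp.1]
    have hpi := Real.pi_pos
    refine (abs_thetaRemainder_succ_le hp.2.2.1 ht).trans (le_of_eq ?_)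
    -- The factor `π√t` cancels the denominator `2π√t` of the term and leaves `1/2`.
    have h1 : √(Real.pi * p.2) = √(p.2 / (Real.pi * p.1)) * (Real.pi * √p.1) := by
      rw [show Real.pi * (p.2 : ℝ) = p.2 / (Real.pi * p.1) * (Real.pi ^ 2 * p.1) by field_simp,
        Real.sqrt_mul (by positivity), Real.sqrt_mul (by positivity), Real.sqrt_sq hpi.le]
    rw [h1]
    have h2 : 0 < √p.1 := Real.sqrt_pos.mpr ht
    have h3 := Real.exp_pos (-2 * Real.pi * p.1)
    generalize ((1 : ℝ) + 1 / 2 ^ (2 * p.2 - 1)) * (1 - 1 / 2 ^ (2 * p.2 - 1))⁻¹ = c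
    field_simp

/-! ### The final estimates -/

/-- A quadratic error suffices, since at `x = e^{-πt}` it has the order `e^{-2πt}` of the remainder.
The lower bound follows from `arctan x ≥ sin(arctan x) = x/√(1+x²)`. -/
theorem abs_arctan_sub_self_le {x : ℝ} (hx : 0 ≤ x) : |Real.arctan x - x| ≤ x ^ 2 := by
  have h1 : Real.arctan x ≤ x := by
    have := Real.le_tan (Real.arctan_nonneg.mpr hx) (Real.arctan_lt_pi_div_two x)
    rwa [Real.tan_arctan] at this
  have h2 : x - x ^ 2 ≤ Real.arctan x := by
    have h3 := Real.sin_le (Real.arctan_nonneg.mpr hx)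
    rw [Real.sin_arctan] at h3
    have h4 : √(1 + x ^ 2) ≤ 1 + x := Real.sqrt_le_iff.mpr ⟨by linarith, by nlinarith⟩
    have h5 : x / (1 + x) ≤ x / √(1 + x ^ 2) := by
      have : 0 < √(1 + x ^ 2) := Real.sqrt_pos.mpr (by positivity)
      gcongr
    refine le_trans ?_ (h5.trans h3)
    rw [le_div_iff₀ (by linarith)]
    nlinarith [pow_nonneg hx 3]
  rw [abs_le]
  constructor <;> nlinarith [sq_nonneg x]

theorem theta_estimates (A : ℝ) : ∃ C t₀ : ℝ, 0 < t₀ ∧ ∀ t : ℝ, t₀ ≤ t → ∀ k : ℕ, 1 ≤ k →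
    |(k : ℝ) - Real.pi * t| ≤ A →
      |thetaTerm k t - Real.exp (-2 * Real.pi * t) / (2 * Real.pi * √t)|
        ≤ Real.exp (-2 * Real.pi * t) / (2 * Real.pi * √t) * (C / t) ∧
      |thetaRemainder (k + 1) t| < (1 / 2) * Real.exp (-2 * Real.pi * t) * (1 + C / t) ∧
      |theta t - thetaApproxArctan k t| < (1 / 2) * Real.exp (-2 * Real.pi * t) * (1 + C / t) ∧
      |(theta t - thetaApprox k t) - (1 / 2) * Real.exp (-Real.pi * t)|
        ≤ C * Real.exp (-2 * Real.pi * t) := by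
  obtain ⟨C₁, hC₁⟩ := (thetaTerm_div_sub_one_isBigO (A := A)).bound
  obtain ⟨m, hm, hR⟩ := exists_abs_thetaRemainder_le (A := A)
  obtain ⟨C₂, hC₂⟩ := hm.bound
  obtain ⟨t₀, h⟩ := eventually_nearLine.mp
    (hC₁.and (hC₂.and (hR.and (eventually_nearLine_bounds (A := A)))))
  -- The summand 2 makes the inequalities for the remainder strict, and gives `½ + ½(1 + C) ≤ C` for
  -- the last estimate; `t ≥ 1` gives `C/t ≤ C`.
  refine ⟨|C₁| + |C₂| + 2, max t₀ 1, by positivity, fun t ht k hk hA => ?_⟩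
  obtain ⟨h1, h2, h3, ht1, -⟩ := h t (le_of_max_le_left ht) k hA
  simp only at h1 h2 h3 ht1
  have ht0 : 0 < t := by linarith
  have hpi := Real.pi_pos
  have hst : 0 < √t := Real.sqrt_pos.mpr ht0
  have hE := Real.exp_pos (-2 * Real.pi * t)
  rw [norm_inv, Real.norm_eq_abs, Real.norm_eq_abs, abs_of_pos ht0, ← div_eq_mul_inv] at h1 h2
  have hm' : m (t, k) < 1 + (|C₁| + |C₂| + 2) / t := by
    have h4 := (abs_le.mp h2).2
    have h5 : C₂ / t < (|C₁| + |C₂| + 2) / t := by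
      gcongr
      linarith [le_abs_self C₂, abs_nonneg C₁]
    linarith
  have hrem : |thetaRemainder (k + 1) t|
      < (1 / 2) * Real.exp (-2 * Real.pi * t) * (1 + (|C₁| + |C₂| + 2) / t) :=
    h3.trans_lt (by gcongr)
  have hsub : theta t - thetaApproxArctan k t = thetaRemainder (k + 1) t := by
    rw [theta_eq k ht0]
    ring
  refine ⟨?_, hrem, by rwa [hsub], ?_⟩
  · have hD : 0 < Real.exp (-2 * Real.pi * t) / (2 * Real.pi * √t) := by positivity
    generalize Real.exp (-2 * Real.pi * t) / (2 * Real.pi * √t) = D at *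
    have h4 : thetaTerm k t - D = D * (thetaTerm k t / D - 1) := by field_simp
    rw [h4, abs_mul, abs_of_pos hD]
    refine mul_le_mul_of_nonneg_left (h1.trans ?_) hD.le
    gcongr
    linarith [le_abs_self C₁, abs_nonneg C₂]
  · have hx := Real.exp_pos (-Real.pi * t)
    have hx2 : Real.exp (-2 * Real.pi * t) = Real.exp (-Real.pi * t) ^ 2 := by
      rw [← Real.exp_nat_mul]
      congr 1
      push_cast
      ring
    have h4 := abs_arctan_sub_self_le hx.le
    have h5 : theta t - thetaApprox k t - 1 / 2 * Real.exp (-Real.pi * t)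
        = 1 / 2 * (Real.arctan (Real.exp (-Real.pi * t)) - Real.exp (-Real.pi * t))
          + thetaRemainder (k + 1) t := by
      rw [← hsub, thetaApproxArctan]
      ring
    have h6 : (|C₁| + |C₂| + 2) / t ≤ |C₁| + |C₂| + 2 := div_le_self (by positivity) ht1
    rw [h5, hx2]
    rw [hx2] at hrem
    refine (abs_add_le _ _).trans ?_
    rw [abs_mul, abs_of_pos (by norm_num : (0 : ℝ) < 1 / 2)]
    have h7 : 1 / 2 * Real.exp (-Real.pi * t) ^ 2 * (1 + (|C₁| + |C₂| + 2) / t)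
        ≤ 1 / 2 * Real.exp (-Real.pi * t) ^ 2 * (1 + (|C₁| + |C₂| + 2)) := by gcongr
    have h8 : 0 ≤ (|C₁| + |C₂|) * Real.exp (-Real.pi * t) ^ 2 := by positivity
    linarith

end RiemannSiegel

theorem mainTheorem11 :
    -- for every `t > 0`, `k_min(t)` is attained and is the index of a smallest term
    (∀ t : ℝ, 0 < t →
      IsLeast {k : ℕ | 1 ≤ k ∧ RiemannSiegel.thetaTerm k t ≤ RiemannSiegel.thetaTerm (k + 1) t}
        (RiemannSiegel.kMin t) ∧
      ∀ j : ℕ, 1 ≤ j →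
        RiemannSiegel.thetaTerm (RiemannSiegel.kMin t) t ≤ RiemannSiegel.thetaTerm j t) ∧
    -- `k_min(t) = π t + O(1)`
    (∃ C t₀ : ℝ, ∀ t : ℝ, t₀ ≤ t → |(RiemannSiegel.kMin t : ℝ) - Real.pi * t| ≤ C) ∧
    -- the estimates for `k = π t + O(1)`, uniformly for a given bound `A` on the `O(1)`
    (∀ A : ℝ, ∃ C t₀ : ℝ, 0 < t₀ ∧ ∀ t : ℝ, t₀ ≤ t → ∀ k : ℕ, 1 ≤ k →
      |(k : ℝ) - Real.pi * t| ≤ A →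
        |RiemannSiegel.thetaTerm k t
            - Real.exp (-2 * Real.pi * t) / (2 * Real.pi * Real.sqrt t)|
          ≤ Real.exp (-2 * Real.pi * t) / (2 * Real.pi * Real.sqrt t) * (C / t) ∧
        |RiemannSiegel.thetaRemainder (k + 1) t|
          < (1 / 2) * Real.exp (-2 * Real.pi * t) * (1 + C / t) ∧
        |RiemannSiegel.theta t - RiemannSiegel.thetaApproxArctan k t|
          < (1 / 2) * Real.exp (-2 * Real.pi * t) * (1 + C / t) ∧
        |(RiemannSiegel.theta t - RiemannSiegel.thetaApprox k t)
            - (1 / 2) * Real.exp (-Real.pi * t)|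
          ≤ C * Real.exp (-2 * Real.pi * t)) ∧
    -- the accuracy attained with `k_min(t)` terms, with and without the arctan term
    ((fun t : ℝ => RiemannSiegel.theta t
        - RiemannSiegel.thetaApproxArctan (RiemannSiegel.kMin t) t)
      =O[Filter.atTop] fun t : ℝ => Real.exp (-2 * Real.pi * t)) ∧
    ((fun t : ℝ => RiemannSiegel.theta t
        - RiemannSiegel.thetaApprox (RiemannSiegel.kMin t) t)
      =Θ[Filter.atTop] fun t : ℝ => Real.exp (-Real.pi * t)) := by
  open RiemannSiegel in
  obtain ⟨C, t₀, ht₀, h⟩ := theta_estimates 2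
  have hk : ∀ t, t₀ ≤ t → 1 ≤ kMin t ∧ |(kMin t : ℝ) - Real.pi * t| ≤ 2 := fun t ht =>
    ⟨one_le_kMin (ht₀.trans_le ht), abs_kMin_sub_le (ht₀.trans_le ht)⟩
  refine ⟨fun t ht => ⟨isLeast_kMin ht, fun j hj => thetaTerm_kMin_le ht hj⟩,
    ⟨2, 1, fun t ht => abs_kMin_sub_le (by linarith)⟩, theta_estimates, ?_, ?_⟩
  · refine IsBigO.of_bound (1 / 2 * (1 + |C| / t₀)) ?_
    filter_upwards [eventually_ge_atTop t₀] with t ht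
    have h1 := (h t ht _ (hk t ht).1 (hk t ht).2).2.2.1
    have h2 : C / t ≤ |C| / t₀ := by
      have := ht₀.trans_le ht
      gcongr
      exact le_abs_self C
    rw [Real.norm_eq_abs, Real.norm_of_nonneg (Real.exp_pos _).le]
    refine h1.le.trans ?_
    have := mul_le_mul_of_nonneg_left h2 (Real.exp_pos (-2 * Real.pi * t)).le
    linarith
  · have hO : (fun t : ℝ => theta t - thetaApprox (kMin t) t - 1 / 2 * Real.exp (-Real.pi * t))
        =O[atTop] fun t : ℝ => Real.exp (-2 * Real.pi * t) := by
      refine IsBigO.of_bound C ?_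
      filter_upwards [eventually_ge_atTop t₀] with t ht
      rw [Real.norm_eq_abs, Real.norm_of_nonneg (Real.exp_pos _).le]
      exact (h t ht _ (hk t ht).1 (hk t ht).2).2.2.2
    have ho : (fun t : ℝ => Real.exp (-2 * Real.pi * t)) =o[atTop]
        fun t : ℝ => 1 / 2 * Real.exp (-Real.pi * t) := by
      refine IsLittleO.const_mul_right (by norm_num) ?_
      rw [Real.isLittleO_exp_comp_exp_comp]
      have : Tendsto (fun t : ℝ => Real.pi * t) atTop atTop :=
        tendsto_id.const_mul_atTop Real.pi_pos
      refine this.congr fun t => ?_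
      ring
    -- As `e^{-2πt}` is negligible, the error without the arctan is even asymptotic to `½ e^{-πt}`.
    have heq : (fun t : ℝ => theta t - thetaApprox (kMin t) t) ~[atTop]
        fun t : ℝ => 1 / 2 * Real.exp (-Real.pi * t) := hO.trans_isLittleO ho
    exact heq.isTheta.trans ((isTheta_refl _ _).const_mul_left (by norm_num))
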